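/- Let $n,d\ge 1$, $T>0$, $Q_T=[0,T)\times\mathbb R^n$, $\bar Q_s=[0,s]\times\mathbb R^n$. For a function $h$ on $Q_T$ put $|h|_0=\sup|h|$, $[h]_1=\sup_{t\ne t',x}\frac{|h(t,x)-h(t',x)|}{|t-t'|^{1/2}}+\sup_{t,x\neq x'}\frac{|h(t,x)-h(t,x')|}{|x-x'|}$ and $|h|_1=|h|_0+[h]_1$; for $U:\mathbb R^n\to\mathbb R$ let $|U|_1$ be its supremum norm plus its Lipschitz constant. Assume, for some $M>0$: (i) $\sigma$ ($n\times d$ matrix valued), $b$ ($\mathbb R^n$-valued), $f$ and $U$ (real valued) satisfy $|\sigma|_1,|b|_1,|f|_1,|U|_1\le M$, and $f(T,\cdot)\ge U$, where $f$ is extended continuously to time $T$; (ii) $H=H(t,x,p)$ is continuous on $Q_T\times\mathbb R^n$, convex in $p$, $H(t,x,p)/|p|\to\infty$ as $|p|\to\infty$ uniformly in $(t,x)\in Q_T$, $[H(\cdot,\cdot,p)]_1\le M$ for every $p$, and $H_*(p)=\inf_{Q_T}H(\cdot,\cdot,p)$ and $H^*(p)=\sup_{Q_T}H(\cdot,\cdot,p)$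 are finite and locally bounded. Consider the obstacle problem $$\max\{-\partial_t u-\tfrac12\mathrm{tr}(\sigma\sigma^T\partial_{xx}u)-b\cdot\partial_xu+H(t,x,\partial_xu),\;u-f\}=0\ \text{in }Q_T,\qquad u(T,\cdot)=U .$$ Let $L(t,x,q)=\sup_p\{p\cdot q-H(t,x,p)\}$, let $W$ be a $d$-dimensional Brownian motion with filtration $(\mathcal F_t)$, and for $0\le t<t+\Delta\le T$ and bounded continuous $\phi$ set $$\mathbf S_t(\Delta)\phi(x)=\min_{y\in\mathbb R^n}\Big\{\Delta L\big(t,x,\tfrac{x-y}{\Delta}\big)+\mathbf E\big[\phi\big(y+b(t,y)\Delta+\sigma(t,y)(W_{t+\Delta}-W_t)\big)\big|\mathcal F_t\big]\Big\}.$$ For $\Delta\in(0,T)$ let $u^\Delta$ be the bounded continuous function on $\bar Q_T$ with $$\max\Big\{\frac{u^\Delta(t,x)-\mathbf S_t(\Delta)u^\Delta(t+\Delta,\cdot)(x)}{\Delta},\;u^\Delta(t,x)-f(t,x)\Big\}=0\quad\text{for }(t,x)\in\bar Q_{T-\Delta},$$ $$u^\Delta(t,x)=\frac{t+\Delta-T}{\Delta}U(x)+\frac{T-t}{\Delta}\min\{\mathbf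 S_{T-\Delta}(\Delta)U(x),f(T-\Delta,x)\}\quad\text{for }T-\Delta<t\le T .$$ Theorem. Suppose that the obstacle problem has a classical solution $u$ that is smooth on $\bar Q_T$ with bounded derivatives of every order. Then $$|u-u^\Delta|\le C\sqrt\Delta\quad\text{in }\bar Q_T\text{ for every }\Delta\in(0,T),$$ where the constant $C$ depends only on $n$, $d$, $T$, $M$, the functions $H_*,H^*$, and a bound for the derivatives of $u$ of order at most four; in particular it does not depend on $\Delta$. -/

import Mathlib

open Set MeasureTheory ProbabilityTheory
open scoped NNReal ENNReal

attribute [local instance] Matrix.frobeniusNormedAddCommGroup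

namespace ObstacleProblem

noncomputable section

/-- The Euclidean space `ℝⁿ`. -/
abbrev E (n : ℕ) : Type := EuclideanSpace ℝ (Fin n)

/-! ### Norms of functions on a time set times `ℝⁿ`

All (semi)norms take values in `[0, ∞]`, so that a bound on them carries finiteness. -/

/-- `|h|₀`, the supremum norm on `I × ℝⁿ`. -/
def supNorm {n : ℕ} {F : Type} [NormedAddCommGroup F] (I : Set ℝ) (h : ℝ → E n → F) : ℝ≥0∞ :=
  ⨆ t ∈ I, ⨆ x, ‖h t x‖ₑ

/-- `[h]_{1,δ}`, the Hölder seminorm of exponent `δ` in time on `I × ℝⁿ`. -/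
def timeSeminorm {n : ℕ} {F : Type} [NormedAddCommGroup F] (I : Set ℝ) (δ : ℝ)
    (h : ℝ → E n → F) : ℝ≥0∞ :=
  ⨆ t ∈ I, ⨆ s ∈ I, ⨆ (_ : t ≠ s), ⨆ x, ‖h t x - h s x‖ₑ / ENNReal.ofReal (|t - s| ^ δ)

/-- `[h]_{2,δ}`, the Hölder seminorm of exponent `δ` in space on `I × ℝⁿ`. -/
def spaceSeminorm {n : ℕ} {F : Type} [NormedAddCommGroup F] (I : Set ℝ) (δ : ℝ)
    (h : ℝ → E n → F) : ℝ≥0∞ :=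
  ⨆ t ∈ I, ⨆ x, ⨆ y, ⨆ (_ : x ≠ y), ‖h t x - h t y‖ₑ / ENNReal.ofReal (‖x - y‖ ^ δ)

/-- `[h]_δ = [h]_{1,δ/2} + [h]_{2,δ}`. -/
def parabolicSeminorm {n : ℕ} {F : Type} [NormedAddCommGroup F] (I : Set ℝ) (δ : ℝ)
    (h : ℝ → E n → F) : ℝ≥0∞ :=
  timeSeminorm I (δ / 2) h + spaceSeminorm I δ h

/-- `|h|_δ = |h|₀ + [h]_δ`. -/
def parabolicNorm {n : ℕ} {F : Type} [NormedAddCommGroup F] (I : Set ℝ) (δ : ℝ)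
    (h : ℝ → E n → F) : ℝ≥0∞ :=
  supNorm I h + parabolicSeminorm I δ h

/-- `|g|_δ = |g|₀ + [g]_δ` for a function `g` on `ℝⁿ`. -/
def holderNorm {n : ℕ} (δ : ℝ) (g : E n → ℝ) : ℝ≥0∞ :=
  (⨆ x, ‖g x‖ₑ) + ⨆ x, ⨆ y, ⨆ (_ : x ≠ y), ‖g x - g y‖ₑ / ENNReal.ofReal (‖x - y‖ ^ δ)

/-! ### The data and the standing assumption -/

/-- The data of the obstacle problem: diffusion coefficient, drift, obstacle, terminal datum and
Hamiltonian `H(t, x, p)`. Values at times outside the relevant interval play no role. -/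
structure Data (n d : ℕ) where
  σ : ℝ → E n → Matrix (Fin n) (Fin d) ℝ
  b : ℝ → E n → E n
  f : ℝ → E n → ℝ
  U : E n → ℝ
  H : ℝ → E n → E n → ℝ

/-- The standing assumption on the data, with constant `M` and with
`Hlow = inf_{(t,x)} H(t,x,·)`, `Hup = sup_{(t,x)} H(t,x,·)`.
The obstacle is normed over the closed time interval, which says that its value at time `T`
is the continuous extension from `[0, T)`. -/
structure Admissible {n d : ℕ} (T M : ℝ) (Hlow Hup : E n → ℝ) (D : Data n d) : Prop where
  norm_σ : parabolicNorm (Ico 0 T) 1 D.σ ≤ ENNReal.ofReal M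
  norm_b : parabolicNorm (Ico 0 T) 1 D.b ≤ ENNReal.ofReal M
  norm_f : parabolicNorm (Icc 0 T) 1 D.f ≤ ENNReal.ofReal M
  norm_U : holderNorm 1 D.U ≤ ENNReal.ofReal M
  terminal_le : ∀ x, D.U x ≤ D.f T x
  continuous_H : ContinuousOn (fun z : ℝ × E n × E n => D.H z.1 z.2.1 z.2.2) (Ico 0 T ×ˢ univ)
  convex_H : ∀ t ∈ Ico 0 T, ∀ x, ConvexOn ℝ univ (D.H t x)
  coercive_H : ∀ A : ℝ, ∃ R : ℝ, 0 ≤ R ∧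
    ∀ t ∈ Ico 0 T, ∀ x p, R < ‖p‖ → A ≤ D.H t x p / ‖p‖
  seminorm_H : ∀ p, parabolicSeminorm (Ico 0 T) 1 (fun t x => D.H t x p) ≤ ENNReal.ofReal M
  isGLB_H : ∀ p, IsGLB {r | ∃ t ∈ Ico 0 T, ∃ x, r = D.H t x p} (Hlow p)
  isLUB_H : ∀ p, IsLUB {r | ∃ t ∈ Ico 0 T, ∃ x, r = D.H t x p} (Hup p)
  locallyBounded_Hlow : ∀ R : ℝ, ∃ A : ℝ, ∀ p, ‖p‖ ≤ R → |Hlow p| ≤ A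
  locallyBounded_Hup : ∀ R : ℝ, ∃ A : ℝ, ∀ p, ‖p‖ ≤ R → |Hup p| ≤ A

/-! ### The obstacle problem and its smooth solutions -/

/-- `g(t,x,p,X) = -½ tr(σσᵀ(t,x) X) - b(t,x)·p + H(t,x,p)`. -/
def Data.g {n d : ℕ} (D : Data n d) (t : ℝ) (x p : E n) (X : Matrix (Fin n) (Fin n) ℝ) : ℝ :=
  -(1 / 2) * (D.σ t x * (D.σ t x).transpose * X).trace - inner ℝ (D.b t x) p + D.H t x p

/-- The Hessian matrix of `φ` at `x`. -/
def hessian {n : ℕ} (φ : E n → ℝ) (x : E n) : Matrix (Fin n) (Fin n) ℝ :=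
  Matrix.of fun i j =>
    fderiv ℝ (fun y => fderiv ℝ φ y (EuclideanSpace.single j 1)) x (EuclideanSpace.single i 1)

/-- The closed domain `[0, T] × ℝⁿ`. -/
def closedDomain (n : ℕ) (T : ℝ) : Set (ℝ × E n) := Icc 0 T ×ˢ univ

/-- The norm at `z` of the `k`-th total derivative in `(t, x)`, relative to `[0, T] × ℝⁿ`
(one-sided in time at `t = 0` and `t = T`). -/
def derivNorm {n : ℕ} (T : ℝ) (u : ℝ → E n → ℝ) (k : ℕ) (z : ℝ × E n) : ℝ :=
  ‖iteratedFDerivWithin ℝ k (fun w : ℝ × E n => u w.1 w.2) (closedDomain n T) z‖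

/-- `u ∈ C_b^∞([0, T] × ℝⁿ)`: smooth up to the boundary, with bounded derivatives of every
order. -/
structure IsSmoothBounded {n : ℕ} (T : ℝ) (u : ℝ → E n → ℝ) : Prop where
  contDiffOn : ContDiffOn ℝ ((⊤ : ℕ∞) : WithTop ℕ∞) (fun z : ℝ × E n => u z.1 z.2) (closedDomain n T)
  bounded : ∀ k : ℕ, ∃ B : ℝ, ∀ z ∈ closedDomain n T, derivNorm T u k z ≤ B

/-- `u` solves `max{-∂ₜu + g(t,x,∂ₓu,∂ₓₓu), u - f} = 0` in `[0, T) × ℝⁿ` and `u(T,·) = U`,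
pointwise. -/
structure IsClassicalSolution {n d : ℕ} (T : ℝ) (D : Data n d) (u : ℝ → E n → ℝ) : Prop where
  equation : ∀ t ∈ Ico 0 T, ∀ x,
    max (-derivWithin (fun s => u s x) (Icc 0 T) t + D.g t x (gradient (u t) x) (hessian (u t) x))
      (u t x - D.f t x) = 0
  terminal : ∀ x, u T x = D.U x

/-! ### Brownian motion -/

/-- `W` is a `d`-dimensional Brownian motion with respect to the filtration `ℱ` under `P`
(in particular `ℱ` may be the augmented filtration of `W`). -/
structure IsBrownianMotion {d : ℕ} {Ω : Type*} [mΩ : MeasurableSpace Ω] (P : Measure Ω)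
    (ℱ : Filtration ℝ≥0 mΩ) (W : ℝ≥0 → Ω → E d) : Prop where
  adapted : Adapted ℱ W
  zero : ∀ᵐ ω ∂P, W 0 ω = 0
  indep : ∀ s t : ℝ≥0, s ≤ t →
    Indep (MeasurableSpace.comap (fun ω => W t ω - W s ω) inferInstance) (ℱ s) P
  law : ∀ s t : ℝ≥0, s ≤ t →
    P.map (fun ω => W t ω - W s ω) =
      (stdGaussian (E d)).map (fun z => Real.sqrt ((t : ℝ) - s) • z)
  continuous_paths : ∀ᵐ ω ∂P, Continuous fun t => W t ω

/-! ### The backward operator and the scheme -/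

/-- The Legendre transform `L(t,x,q) = sup_p {p·q - H(t,x,p)}`. -/
def Data.L {n d : ℕ} (D : Data n d) (t : ℝ) (x q : E n) : ℝ :=
  ⨆ p : E n, (inner ℝ p q - D.H t x p)

/-- `Y_s^{t,y} = y + b(t,y)(s - t) + σ(t,y)(W_s - W_t)`. -/
def Data.Y {n d : ℕ} (D : Data n d) {Ω : Type*} (W : ℝ≥0 → Ω → E d) (t : ℝ) (y : E n) (s : ℝ)
    (ω : Ω) : E n :=
  y + (s - t) • D.b t y +
    WithLp.toLp 2 ((D.σ t y).mulVec (W s.toNNReal ω - W t.toNNReal ω).ofLp)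

/-- The backward operator
`S_t(Δ)φ(x) = min_y {Δ L(t, x, (x - y)/Δ) + E[φ(Y_{t+Δ}^{t,y}) | ℱ_t]}`.
The conditional expectation is almost surely equal to a constant, here called `c`. -/
def Data.backward {n d : ℕ} (D : Data n d) {Ω : Type*} [mΩ : MeasurableSpace Ω] (P : Measure Ω)
    (ℱ : Filtration ℝ≥0 mΩ) (W : ℝ≥0 → Ω → E d) (t Δ : ℝ) (φ : E n → ℝ) (x : E n) : ℝ :=
  sInf {r : ℝ | ∃ (y : E n) (c : ℝ),
    (P[fun ω => φ (D.Y W t y (t + Δ) ω) | ℱ t.toNNReal] =ᵐ[P] fun _ => c) ∧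
      r = Δ * D.L t x (Δ⁻¹ • (x - y)) + c}

/-- `S̄(Δ,t,x,p,v) = max{(p - S_t(Δ)v(x))/Δ, p - f(t,x)}`. -/
def Data.scheme {n d : ℕ} (D : Data n d) {Ω : Type*} [mΩ : MeasurableSpace Ω] (P : Measure Ω)
    (ℱ : Filtration ℝ≥0 mΩ) (W : ℝ≥0 → Ω → E d) (Δ t : ℝ) (x : E n) (p : ℝ) (v : E n → ℝ) : ℝ :=
  max ((p - D.backward P ℱ W t Δ v x) / Δ) (p - D.f t x)

/-- The linear interpolation `g^Δ` on the last time interval `(T - Δ, T]`. -/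
def Data.lastInterval {n d : ℕ} (D : Data n d) {Ω : Type*} [mΩ : MeasurableSpace Ω]
    (P : Measure Ω) (ℱ : Filtration ℝ≥0 mΩ) (W : ℝ≥0 → Ω → E d) (T Δ t : ℝ) (x : E n) : ℝ :=
  (t + Δ - T) / Δ * D.U x +
    (T - t) / Δ * min (D.backward P ℱ W (T - Δ) Δ D.U x) (D.f (T - Δ) x)

/-- `v ∈ C_b([0, T] × ℝⁿ)` solves the approximation scheme with time step `Δ`. -/
structure IsSchemeSolution {n d : ℕ} {Ω : Type*} [mΩ : MeasurableSpace Ω] (P : Measure Ω)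
    (ℱ : Filtration ℝ≥0 mΩ) (W : ℝ≥0 → Ω → E d) (T : ℝ) (D : Data n d) (Δ : ℝ)
    (v : ℝ → E n → ℝ) : Prop where
  continuousOn : ContinuousOn (fun z : ℝ × E n => v z.1 z.2) (closedDomain n T)
  bounded : ∃ B : ℝ, ∀ t ∈ Icc 0 T, ∀ x, |v t x| ≤ B
  equation : ∀ t ∈ Icc 0 (T - Δ), ∀ x, D.scheme P ℱ W Δ t x (v t x) (v (t + Δ)) = 0
  last : ∀ t ∈ Ioc (T - Δ) T, ∀ x, v t x = D.lastInterval P ℱ W T Δ t x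

end

end ObstacleProblem

/-! The smooth solution almost satisfies the dynamic programming relation of the scheme: `u(t,x)`
equals `min(S_t(Δ)u(t+Δ,·)(x), f(t,x))` up to `O(Δ^{3/2})`. The scheme satisfies it exactly, and
both `S_t(Δ)` and the minimum with `f` are nonexpansive in the supremum norm, so the `O(T/Δ)` local
errors add up to `O(√Δ)`. On the last interval the error is `O(Δ)` plus one local error, because `u`
is Lipschitz in time and the scheme interpolates linearly there.

The local error (`exists_consistency`) comes from writing `y = x - Δq` and expanding the Gaussian
average of `u(t+Δ,·)` at `(t,x)`. Odd moments up to order two cancel, the second moment produces the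
trace term, and the third order remainder is of size `Δ^{3/2}`. The quantity to minimize becomes `u
+ Δ(L(q) - p·q + generator)` with `p = ∂ₓu(t,x)`, and duality turns `inf_q (L(q) - p·q)` into
`-H(p)`.

Uniformity requires bounded `q`. From below, `L(q) ≥ (K+1)|q| - A` beats the slope `K` of `u`, so
large `q` are never better. From above, an approximate subgradient of `H(t,x,·)` at `p` is bounded
through the envelopes. Thus `H` enters the constant only through a bound `A` for the envelopes on
`|p| ≤ K + 1`. -/

namespace ObstacleProblem

/-! ### Taylor estimates relative to a convex set. -/

/-- `D1` and `D2` are the first two derivatives of `F` relative to `S`; all three are bounded by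
`K`, and `D2` is Lipschitz with constant `K` on `S`. -/
structure HasBoundedJet {V : Type*} [NormedAddCommGroup V] [NormedSpace ℝ V] (S : Set V) (K : ℝ)
    (F : V → ℝ) (D1 : V → V →L[ℝ] ℝ) (D2 : V → V →L[ℝ] V →L[ℝ] ℝ) : Prop where
  convex : Convex ℝ S
  nonneg : 0 ≤ K
  abs_le : ∀ z ∈ S, |F z| ≤ K
  hasFDerivWithinAt : ∀ z ∈ S, HasFDerivWithinAt F (D1 z) S z
  hasFDerivWithinAt_D1 : ∀ z ∈ S, HasFDerivWithinAt D1 (D2 z) S z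
  norm_D1_le : ∀ z ∈ S, ‖D1 z‖ ≤ K
  norm_D2_le : ∀ z ∈ S, ‖D2 z‖ ≤ K
  lipschitz_D2 : ∀ z ∈ S, ∀ w ∈ S, ‖D2 w - D2 z‖ ≤ K * ‖w - z‖

namespace HasBoundedJet

variable {V : Type*} [NormedAddCommGroup V] [NormedSpace ℝ V] {S : Set V} {K : ℝ}
  {F : V → ℝ} {D1 : V → V →L[ℝ] ℝ} {D2 : V → V →L[ℝ] V →L[ℝ] ℝ}

theorem abs_sub_le (h : HasBoundedJet S K F D1 D2) {z w : V} (hz : z ∈ S) (hw : w ∈ S) :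
    |F w - F z| ≤ K * ‖w - z‖ :=
  h.convex.norm_image_sub_le_of_norm_hasFDerivWithin_le h.hasFDerivWithinAt h.norm_D1_le hz hw

theorem norm_D1_sub_le (h : HasBoundedJet S K F D1 D2) {z w : V} (hz : z ∈ S) (hw : w ∈ S) :
    ‖D1 w - D1 z‖ ≤ K * ‖w - z‖ :=
  h.convex.norm_image_sub_le_of_norm_hasFDerivWithin_le h.hasFDerivWithinAt_D1 h.norm_D2_le hz hw

/-- First order Taylor expansion of a function whose derivative is Lipschitz at `z`. -/
theorem _root_.Convex.norm_taylor_one_le {G : Type*} [NormedAddCommGroup G] [NormedSpace ℝ G]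
    (hS : Convex ℝ S) {f : V → G} {f' : V → V →L[ℝ] G}
    (hf : ∀ z ∈ S, HasFDerivWithinAt f (f' z) S z) {z w : V} (hK : 0 ≤ K)
    (hf' : ∀ y ∈ S, ‖f' y - f' z‖ ≤ K * ‖y - z‖) (hz : z ∈ S) (hw : w ∈ S) :
    ‖f w - f z - f' z (w - z)‖ ≤ K * ‖w - z‖ ^ 2 := by
  have := Convex.norm_image_sub_le_of_norm_hasFDerivWithin_le'
    (s := S ∩ Metric.closedBall z ‖w - z‖) (f := f) (f' := f') (φ := f' z)
    (C := K * ‖w - z‖) (x := z) (y := w)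
    (fun y hy => (hf y hy.1).mono inter_subset_left)
    (fun y hy => (hf' y hy.1).trans
      (mul_le_mul_of_nonneg_left (by simpa [dist_eq_norm] using hy.2) hK))
    (hS.inter (convex_closedBall _ _)) ⟨hz, by simp⟩ ⟨hw, by simp [dist_eq_norm]⟩
  exact this.trans_eq (by ring)

theorem abs_taylor_one_le (h : HasBoundedJet S K F D1 D2) {z w : V} (hz : z ∈ S) (hw : w ∈ S) :
    |F w - F z - D1 z (w - z)| ≤ K * ‖w - z‖ ^ 2 :=
  h.convex.norm_taylor_one_le h.hasFDerivWithinAt h.nonneg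
    (fun _ hy => h.norm_D1_sub_le hz hy) hz hw

theorem norm_D1_taylor_one_le (h : HasBoundedJet S K F D1 D2) {z w : V} (hz : z ∈ S)
    (hw : w ∈ S) : ‖D1 w - D1 z - D2 z (w - z)‖ ≤ K * ‖w - z‖ ^ 2 :=
  h.convex.norm_taylor_one_le h.hasFDerivWithinAt_D1 h.nonneg
    (fun _ hy => h.lipschitz_D2 _ hz _ hy) hz hw

/-- Along the segment, the derivative of the remainder is the first order remainder of `D1` applied
to `v`, hence at most `K‖v‖³`; the mean value inequality finishes. The sharp factor is not needed.
-/
theorem abs_taylor_two_le (h : HasBoundedJet S K F D1 D2) {z v : V} (hz : z ∈ S)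
    (hv : z + v ∈ S) :
    |F (z + v) - F z - D1 z v - D2 z v v / 2| ≤ K * ‖v‖ ^ 3 := by
  have hmem : ∀ s ∈ Icc (0 : ℝ) 1, z + s • v ∈ S := fun s hs => by
    have := h.convex.add_smul_sub_mem hz hv hs
    simpa using this
  have key := norm_image_sub_le_of_norm_deriv_le_segment_01'
    (f := fun s : ℝ => F (z + s • v) - s * D1 z v - s ^ 2 / 2 * D2 z v v)
    (f' := fun s : ℝ => D1 (z + s • v) v - D1 z v - s * D2 z v v) (C := K * ‖v‖ ^ 3)
    (fun s hs => by
      have h1 : HasDerivWithinAt (fun s : ℝ => z + s • v) v (Icc 0 1) s := by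
        simpa using ((hasDerivWithinAt_id s (Icc (0 : ℝ) 1)).smul_const v).const_add z
      have h2 := (h.hasFDerivWithinAt _ (hmem s hs)).comp_hasDerivWithinAt s h1
        (fun r hr => hmem r hr)
      have h3 := ((hasDerivWithinAt_id s (Icc (0 : ℝ) 1)).mul_const (D1 z v))
      have h4 := (((hasDerivWithinAt_id s (Icc (0 : ℝ) 1)).pow 2).div_const 2).mul_const
        (D2 z v v)
      refine ((h2.sub h3).sub h4).congr_deriv ?_
      simp)
    (fun s hs => by
      have hs' : s ∈ Icc (0 : ℝ) 1 := ⟨hs.1, hs.2.le⟩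
      have h1 := h.norm_D1_taylor_one_le hz (hmem s hs')
      have h2 : D1 (z + s • v) v - D1 z v - s * D2 z v v =
          (D1 (z + s • v) - D1 z - D2 z (z + s • v - z)) v := by simp
      rw [h2]
      refine (ContinuousLinearMap.le_opNorm _ _).trans ?_
      calc _ ≤ K * ‖z + s • v - z‖ ^ 2 * ‖v‖ := by gcongr
        _ ≤ K * ‖v‖ ^ 2 * ‖v‖ := by
            have : ‖z + s • v - z‖ ≤ ‖v‖ := by
              rw [add_sub_cancel_left, norm_smul, Real.norm_of_nonneg hs.1]
              exact mul_le_of_le_one_left (norm_nonneg _) hs.2.le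
            have := h.nonneg
            gcongr
        _ = _ := by ring)
  refine le_trans (le_of_eq ?_) key
  rw [Real.norm_eq_abs]
  congr 1
  simp
  ring

end HasBoundedJet

theorem convex_closedDomain (n : ℕ) (T : ℝ) : Convex ℝ (closedDomain n T) :=
  (convex_Icc 0 T).prod convex_univ

theorem uniqueDiffOn_closedDomain (n : ℕ) {T : ℝ} (hT : 0 < T) :
    UniqueDiffOn ℝ (closedDomain n T) :=
  (uniqueDiffOn_Icc hT).prod uniqueDiffOn_univ

/-- Bounds on iterated derivatives pass to iterated `fderivWithin` by unique differentiability of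
the slab; the Lipschitz bound on `D2` is the third derivative bound plus convexity. -/
theorem IsSmoothBounded.hasBoundedJet {n : ℕ} {T K : ℝ} (hT : 0 < T) {u : ℝ → E n → ℝ}
    (hu : IsSmoothBounded T u)
    (hK : ∀ k ≤ 4, ∀ z ∈ closedDomain n T, derivNorm T u k z ≤ K) :
    HasBoundedJet (closedDomain n T) K (fun z => u z.1 z.2)
      (fderivWithin ℝ (fun z : ℝ × E n => u z.1 z.2) (closedDomain n T))
      (fderivWithin ℝ (fderivWithin ℝ (fun z : ℝ × E n => u z.1 z.2) (closedDomain n T))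
        (closedDomain n T)) := by
  have hU := uniqueDiffOn_closedDomain n hT
  have c1 := hu.contDiffOn.fderivWithin hU (m := ((⊤ : ℕ∞) : WithTop ℕ∞)) (by simp)
  have c2 := c1.fderivWithin hU (m := ((⊤ : ℕ∞) : WithTop ℕ∞)) (by simp)
  have e1 : ∀ z ∈ closedDomain n T, ∀ k, derivNorm T u (k + 1) z =
      ‖iteratedFDerivWithin ℝ k (fderivWithin ℝ (fun z : ℝ × E n => u z.1 z.2)
        (closedDomain n T)) (closedDomain n T) z‖ := fun z hz k =>
    (norm_iteratedFDerivWithin_fderivWithin hU hz).symm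
  have e2 : ∀ z ∈ closedDomain n T, ∀ k, derivNorm T u (k + 1 + 1) z =
      ‖iteratedFDerivWithin ℝ k (fderivWithin ℝ (fderivWithin ℝ
        (fun z : ℝ × E n => u z.1 z.2) (closedDomain n T)) (closedDomain n T))
        (closedDomain n T) z‖ := fun z hz k =>
    (e1 z hz (k + 1)).trans (norm_iteratedFDerivWithin_fderivWithin hU hz).symm
  refine ⟨convex_closedDomain n T, ?_, ?_, ?_, ?_, ?_, ?_, ?_⟩
  · exact (norm_nonneg _).trans (hK 0 (by norm_num) (0, 0) ⟨⟨le_rfl, hT.le⟩, mem_univ _⟩)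
  · intro z hz
    have := hK 0 (by norm_num) z hz
    rwa [derivNorm, norm_iteratedFDerivWithin_zero] at this
  · exact fun z hz => (hu.contDiffOn.differentiableOn (by simp) z hz).hasFDerivWithinAt
  · exact fun z hz => (c1.differentiableOn (by simp) z hz).hasFDerivWithinAt
  · intro z hz
    have := hK 1 (by norm_num) z hz
    rw [e1 z hz 0, norm_iteratedFDerivWithin_zero] at this
    exact this
  · intro z hz
    have := hK 2 (by norm_num) z hz
    rw [e2 z hz 0, norm_iteratedFDerivWithin_zero] at this
    exact this
  · intro z hz w hw
    refine (convex_closedDomain n T).norm_image_sub_le_of_norm_hasFDerivWithin_le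
      (fun y hy => (c2.differentiableOn (by simp) y hy).hasFDerivWithinAt) (fun y hy => ?_) hz hw
    have := hK 3 (by norm_num) y hy
    rw [e2 y hy 1, ← norm_iteratedFDerivWithin_fderivWithin hU hy,
      norm_iteratedFDerivWithin_zero] at this
    exact this

/-! ### Time derivative, gradient and Hessian read off the joint derivatives. -/

section Slices

variable {n : ℕ} {T K : ℝ} {u : ℝ → E n → ℝ} {D1 : ℝ × E n → ℝ × E n →L[ℝ] ℝ}
  {D2 : ℝ × E n → ℝ × E n →L[ℝ] ℝ × E n →L[ℝ] ℝ}

theorem HasBoundedJet.derivWithin_time (hT : 0 < T)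
    (h : HasBoundedJet (closedDomain n T) K (fun z => u z.1 z.2) D1 D2) {t : ℝ}
    (ht : t ∈ Icc 0 T) (x : E n) :
    derivWithin (fun s => u s x) (Icc 0 T) t = D1 (t, x) (1, 0) := by
  have h1 : HasDerivWithinAt (fun s : ℝ => (s, x)) ((1 : ℝ), (0 : E n)) (Icc 0 T) t :=
    (hasDerivWithinAt_id t _).prodMk (hasDerivWithinAt_const _ _ _)
  have h2 : MapsTo (fun s : ℝ => (s, x)) (Icc 0 T) (closedDomain n T) :=
    fun s hs => ⟨hs, mem_univ _⟩
  exact ((h.hasFDerivWithinAt (t, x) ⟨ht, mem_univ _⟩).comp_hasDerivWithinAt t h1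
    h2).derivWithin (uniqueDiffOn_Icc hT t ht)

/-- Even at `t = 0` and `t = T` the spatial derivative is unrestricted, because the slice of the
slab at a fixed time is the whole space. -/
theorem hasFDerivAt_slice {G : Type*} [NormedAddCommGroup G] [NormedSpace ℝ G]
    {f : ℝ × E n → G} {t : ℝ} (ht : t ∈ Icc 0 T) {x : E n} {f' : ℝ × E n →L[ℝ] G}
    (hf : HasFDerivWithinAt f f' (closedDomain n T) (t, x)) :
    HasFDerivAt (fun y => f (t, y)) (f'.comp (ContinuousLinearMap.inr ℝ ℝ (E n))) x := by
  have h1 : HasFDerivWithinAt (fun y : E n => (t, y)) (ContinuousLinearMap.inr ℝ ℝ (E n))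
      univ x := (hasFDerivAt_prodMk_right t x).hasFDerivWithinAt
  exact (hf.comp x h1 (fun y _ => ⟨ht, mem_univ _⟩)).hasFDerivAt Filter.univ_mem

theorem HasBoundedJet.continuous_slice
    (h : HasBoundedJet (closedDomain n T) K (fun z => u z.1 z.2) D1 D2) {t : ℝ}
    (ht : t ∈ Icc 0 T) : Continuous (u t) :=
  continuous_iff_continuousAt.2 fun x => (hasFDerivAt_slice (f := fun z => u z.1 z.2) ht
    (h.hasFDerivWithinAt (t, x) ⟨ht, mem_univ _⟩)).continuousAt

theorem HasBoundedJet.inner_gradient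
    (h : HasBoundedJet (closedDomain n T) K (fun z => u z.1 z.2) D1 D2) {t : ℝ}
    (ht : t ∈ Icc 0 T) (x v : E n) : inner ℝ v (gradient (u t) x) = D1 (t, x) (0, v) := by
  have h1 : HasFDerivAt (u t) _ x :=
    hasFDerivAt_slice ht (h.hasFDerivWithinAt (t, x) ⟨ht, mem_univ _⟩)
  rw [real_inner_comm, gradient, InnerProductSpace.toDual_symm_apply, h1.fderiv]
  simp

theorem HasBoundedJet.norm_gradient_le
    (h : HasBoundedJet (closedDomain n T) K (fun z => u z.1 z.2) D1 D2) {t : ℝ}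
    (ht : t ∈ Icc 0 T) (x : E n) : ‖gradient (u t) x‖ ≤ K := by
  have h1 : HasFDerivAt (u t) _ x :=
    hasFDerivAt_slice ht (h.hasFDerivWithinAt (t, x) ⟨ht, mem_univ _⟩)
  rw [gradient, LinearIsometryEquiv.norm_map, h1.fderiv]
  refine ContinuousLinearMap.opNorm_le_bound _ h.nonneg fun v => ?_
  calc _ ≤ ‖D1 (t, x)‖ * ‖((0 : ℝ), v)‖ := (D1 (t, x)).le_opNorm _
    _ ≤ K * ‖v‖ := by
      have := h.norm_D1_le (t, x) ⟨ht, mem_univ _⟩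
      simp only [Prod.norm_mk, norm_zero, norm_nonneg, sup_of_le_right]
      gcongr

theorem HasBoundedJet.hessian_apply
    (h : HasBoundedJet (closedDomain n T) K (fun z => u z.1 z.2) D1 D2) {t : ℝ}
    (ht : t ∈ Icc 0 T) (x : E n) (i j : Fin n) :
    hessian (u t) x i j = D2 (t, x) (0, EuclideanSpace.single i 1)
      (0, EuclideanSpace.single j 1) := by
  have h1 : ∀ y, fderiv ℝ (u t) y (EuclideanSpace.single j 1) =
      D1 (t, y) (0, EuclideanSpace.single j 1) := fun y => by
    have h1 : HasFDerivAt (u t) _ y :=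
      hasFDerivAt_slice ht (h.hasFDerivWithinAt (t, y) ⟨ht, mem_univ _⟩)
    rw [h1.fderiv]; simp
  have h2 := (hasFDerivAt_slice ht (h.hasFDerivWithinAt_D1 (t, x) ⟨ht, mem_univ _⟩)).clm_apply
    (hasFDerivAt_const ((0 : ℝ), EuclideanSpace.single j (1 : ℝ)) x)
  simp only [hessian, Matrix.of_apply, h1]
  rw [h2.fderiv]
  simp

end Slices

end ObstacleProblem

namespace ObstacleProblem

/-! ### Moments and Taylor expansions of Gaussian averages. -/

section Gaussian

variable {d : ℕ}

theorem integrable_norm_pow_stdGaussian (k : ℕ) :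
    Integrable (fun z : E d => ‖z‖ ^ k) (stdGaussian (E d)) := by
  rcases Nat.eq_zero_or_pos k with rfl | hk
  · simp
  · have := (IsGaussian.memLp_id (stdGaussian (E d)) k (by simp)).integrable_norm_pow hk.ne'
    simpa using this

theorem integrable_coord_mul_stdGaussian (i j : Fin d) :
    Integrable (fun z : E d => z i * z j) (stdGaussian (E d)) := by
  refine (integrable_norm_pow_stdGaussian 2).mono' (by fun_prop) (ae_of_all _ fun z => ?_)
  rw [norm_mul, sq]
  gcongr <;> exact PiLp.norm_apply_le _ _

theorem integral_coord_mul_stdGaussian (i j : Fin d) :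
    ∫ z : E d, z i * z j ∂(stdGaussian (E d)) = if i = j then 1 else 0 := by
  have h := covarianceBilin_apply (μ := stdGaussian (E d)) IsGaussian.memLp_two_id
    (EuclideanSpace.single i 1) (EuclideanSpace.single j 1)
  rw [covarianceBilin_stdGaussian] at h
  simp only [id_eq, integral_id_stdGaussian, sub_zero, EuclideanSpace.inner_single_left, map_one,
    one_mul] at h
  rw [← h]
  change inner ℝ (EuclideanSpace.single i (1 : ℝ)) (EuclideanSpace.single j (1 : ℝ)) = _
  simp [EuclideanSpace.inner_single_left]

theorem bilin_eq_sum (B : E d →L[ℝ] E d →L[ℝ] ℝ) (z : E d) :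
    B z z = ∑ i, ∑ j, z i * z j * B (EuclideanSpace.single i 1) (EuclideanSpace.single j 1) := by
  have hz : z = ∑ i, z i • EuclideanSpace.single i (1 : ℝ) := by
    ext k
    simp [Finset.sum_apply, Pi.single_apply]
  conv_lhs => rw [hz]
  simp only [map_sum, map_smul, _root_.sum_apply, _root_.smul_apply,
    smul_eq_mul, Finset.mul_sum]
  rw [Finset.sum_comm]
  exact Finset.sum_congr rfl fun i _ => Finset.sum_congr rfl fun j _ => by ring

theorem integral_bilin_stdGaussian (B : E d →L[ℝ] E d →L[ℝ] ℝ) :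
    ∫ z : E d, B z z ∂(stdGaussian (E d)) =
      ∑ k, B (EuclideanSpace.single k 1) (EuclideanSpace.single k 1) := by
  simp only [bilin_eq_sum B]
  rw [integral_finsetSum _ fun i _ => integrable_finsetSum _ fun j _ =>
    (integrable_coord_mul_stdGaussian i j).mul_const _]
  simp only [integral_finsetSum _ fun j _ =>
    (integrable_coord_mul_stdGaussian _ j).mul_const _, integral_mul_const,
    integral_coord_mul_stdGaussian]
  simp

theorem integrable_bilin_stdGaussian (B : E d →L[ℝ] E d →L[ℝ] ℝ) :
    Integrable (fun z : E d => B z z) (stdGaussian (E d)) := by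
  simp only [bilin_eq_sum B]
  exact integrable_finsetSum _ fun i _ => integrable_finsetSum _ fun j _ =>
    (integrable_coord_mul_stdGaussian i j).mul_const _

theorem integrable_dual_stdGaussian (L : E d →L[ℝ] ℝ) :
    Integrable (fun z : E d => L z) (stdGaussian (E d)) :=
  L.integrable_comp IsGaussian.integrable_id

/-- Second order expansion of a Gaussian average. -/
theorem abs_integral_sub_taylor_two_le {V : Type*} [NormedAddCommGroup V] [NormedSpace ℝ V]
    {f : E d → ℝ} (hf : Integrable f (stdGaussian (E d))) (D1 : V →L[ℝ] ℝ)
    (D2 : V →L[ℝ] V →L[ℝ] ℝ) (c K s ρ N : ℝ) (m : V) (A : E d →L[ℝ] V) (hs : 0 ≤ s) (hK : 0 ≤ K)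
    (hm : ‖m‖ ≤ ρ) (hA : ‖A‖ ≤ N)
    (h : ∀ z, |f z - c - D1 (m + s • A z) - D2 (m + s • A z) (m + s • A z) / 2|
      ≤ K * ‖m + s • A z‖ ^ 3) :
    |(∫ z, f z ∂(stdGaussian (E d))) - c - D1 m - D2 m m / 2 - s ^ 2 / 2 *
      ∑ k, D2 (A (EuclideanSpace.single k 1)) (A (EuclideanSpace.single k 1))|
      ≤ 4 * K * (ρ ^ 3 + s ^ 3 * (N ^ 3 * ∫ z : E d, ‖z‖ ^ 3 ∂(stdGaussian (E d)))) := by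
  set γ := stdGaussian (E d)
  let B : E d →L[ℝ] E d →L[ℝ] ℝ := (((ContinuousLinearMap.compL ℝ (E d) V ℝ).flip A).comp D2).comp A
  have hB : ∀ z, B z z = D2 (A z) (A z) := fun z => rfl
  -- `l` gathers all terms linear in `z`, including both cross terms of `D2`, whose symmetry is not
  -- assumed; its mean is zero.
  let l : E d →L[ℝ] ℝ := s • (D1.comp A + (1 / 2 : ℝ) • ((D2 m).comp A + (D2.flip m).comp A))
  have hl : ∀ z, l z = s * D1 (A z) + s * (D2 m (A z) + D2 (A z) m) / 2 := fun z => by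
    simp [l]; ring
  have hρ : 0 ≤ ρ := (norm_nonneg _).trans hm
  have hN : 0 ≤ N := (norm_nonneg _).trans hA
  have h1 : Integrable (fun z => l z) γ := integrable_dual_stdGaussian l
  have h2 : Integrable (fun z => s ^ 2 / 2 * B z z) γ := (integrable_bilin_stdGaussian B).const_mul _
  have h12 : Integrable (fun z => l z + s ^ 2 / 2 * B z z) γ := h1.add h2
  have h12c : Integrable (fun z => l z + s ^ 2 / 2 * B z z + (c + D1 m + D2 m m / 2)) γ :=
    h12.add (integrable_const _)
  have e : ∀ z, f z - c - D1 (m + s • A z) - D2 (m + s • A z) (m + s • A z) / 2 =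
      f z - (l z + s ^ 2 / 2 * B z z + (c + D1 m + D2 m m / 2)) := fun z => by
    rw [hl, hB]; simp; ring
  have hint : (∫ z, f z ∂γ) - c - D1 m - D2 m m / 2 - s ^ 2 / 2 *
      ∑ k, D2 (A (EuclideanSpace.single k 1)) (A (EuclideanSpace.single k 1)) =
      ∫ z, (f z - (l z + s ^ 2 / 2 * B z z + (c + D1 m + D2 m m / 2))) ∂γ := by
    rw [integral_sub hf h12c, integral_add h12 (integrable_const _), integral_add h1 h2, integral_strongDual_stdGaussian,
      integral_const_mul, integral_bilin_stdGaussian]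
    simp [hB]; ring
  have h3 := (integrable_norm_pow_stdGaussian (d := d) 3)
  rw [hint, ← Real.norm_eq_abs]
  refine (norm_integral_le_of_norm_le (g := fun z => 4 * K * (ρ ^ 3 + s ^ 3 * (N ^ 3 * ‖z‖ ^ 3)))
    (((integrable_const _).add ((h3.const_mul _).const_mul _)).const_mul _)
    (ae_of_all _ fun z => ?_)).trans_eq ?_
  · rw [← e, Real.norm_eq_abs]
    refine (h z).trans ?_
    have : ‖m + s • A z‖ ≤ ρ + s * (N * ‖z‖) := by
      refine (norm_add_le _ _).trans (add_le_add hm ?_)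
      rw [norm_smul, Real.norm_of_nonneg hs]
      have := A.le_opNorm z
      gcongr
      exact this.trans (by gcongr)
    calc K * ‖m + s • A z‖ ^ 3 ≤ K * (ρ + s * (N * ‖z‖)) ^ 3 := by gcongr
      -- Convexity of the cube, `(a+b)³ ≤ 4(a³+b³)`, is the origin of the factor 4.
      _ ≤ K * (2 ^ (3 - 1) * (ρ ^ 3 + (s * (N * ‖z‖)) ^ 3)) := by
        gcongr; exact add_pow_le hρ (by positivity) 3
      _ = _ := by ring
  · rw [integral_const_mul, integral_add (integrable_const _) ((h3.const_mul _).const_mul _),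
      integral_const_mul, integral_const_mul]
    simp [γ]

/-- First order lower bound of a Gaussian average. -/
theorem le_integral_of_taylor_one {V : Type*} [NormedAddCommGroup V] [NormedSpace ℝ V]
    {f : E d → ℝ} (hf : Integrable f (stdGaussian (E d))) (D1 : V →L[ℝ] ℝ)
    (c K s N : ℝ) (A : E d →L[ℝ] V) (hK : 0 ≤ K) (hA : ‖A‖ ≤ N)
    (h : ∀ z, |f z - c - D1 (s • A z)| ≤ K * ‖s • A z‖ ^ 2) :
    c - K * (s ^ 2 * (N ^ 2 * ∫ z : E d, ‖z‖ ^ 2 ∂(stdGaussian (E d)))) ≤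
      ∫ z, f z ∂(stdGaussian (E d)) := by
  set γ := stdGaussian (E d)
  have h1 : Integrable (fun z => (s • D1.comp A) z) γ := integrable_dual_stdGaussian _
  have h3 := (integrable_norm_pow_stdGaussian (d := d) 2)
  have hN : 0 ≤ N := (norm_nonneg _).trans hA
  have h1c : Integrable (fun z => c + (s • D1.comp A) z) γ := (integrable_const _).add h1
  have h3c : Integrable (fun z : E d => K * (s ^ 2 * (N ^ 2 * ‖z‖ ^ 2))) γ :=
    ((h3.const_mul _).const_mul _).const_mul _
  have : ∫ z, (c + (s • D1.comp A) z - K * (s ^ 2 * (N ^ 2 * ‖z‖ ^ 2))) ∂γ ≤ ∫ z, f z ∂γ := by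
    refine integral_mono (h1c.sub h3c) hf fun z => ?_
    have h2 := (abs_le.1 (h z)).1
    have : K * ‖s • A z‖ ^ 2 ≤ K * (s ^ 2 * (N ^ 2 * ‖z‖ ^ 2)) := by
      have := A.le_opNorm z
      rw [norm_smul, mul_pow, Real.norm_eq_abs, sq_abs, ← mul_pow N]
      gcongr
      exact this.trans (by gcongr)
    simp at h2 ⊢
    linarith
  refine le_trans (le_of_eq ?_) this
  rw [integral_sub h1c h3c, integral_add (integrable_const _) h1, integral_strongDual_stdGaussian]
  simp [integral_const_mul, γ]

end Gaussian

/-! ### Matrices as linear maps, with the Frobenius norm. -/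

/-- The linear map `z ↦ σ z` between Euclidean spaces. -/
noncomputable def matrixCLM {n d : ℕ} (σ : Matrix (Fin n) (Fin d) ℝ) : E d →L[ℝ] E n :=
  LinearMap.toContinuousLinearMap (Matrix.toEuclideanLin σ)

theorem matrixCLM_apply {n d : ℕ} (σ : Matrix (Fin n) (Fin d) ℝ) (z : E d) :
    matrixCLM σ z = WithLp.toLp 2 (σ.mulVec z.ofLp) := rfl

theorem matrixCLM_sub {n d : ℕ} (σ τ : Matrix (Fin n) (Fin d) ℝ) :
    matrixCLM (σ - τ) = matrixCLM σ - matrixCLM τ := by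
  simp [matrixCLM]

theorem norm_matrixCLM_le {n d : ℕ} (σ : Matrix (Fin n) (Fin d) ℝ) : ‖matrixCLM σ‖ ≤ ‖σ‖ := by
  refine ContinuousLinearMap.opNorm_le_bound _ (norm_nonneg _) fun z => ?_
  have hσ : ‖σ‖ = Real.sqrt (∑ i, ∑ j, ‖σ i j‖ ^ 2) := by
    rw [Matrix.frobenius_norm_def, Real.sqrt_eq_rpow]; norm_cast
  rw [hσ, EuclideanSpace.norm_eq, EuclideanSpace.norm_eq z, ← Real.sqrt_mul (by positivity)]
  refine Real.sqrt_le_sqrt ?_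
  rw [Finset.sum_mul]
  refine Finset.sum_le_sum fun i _ => ?_
  simp only [Real.norm_eq_abs, sq_abs, matrixCLM_apply, Matrix.mulVec, dotProduct]
  exact Finset.sum_mul_sq_le_sq_mul_sq _ _ _

theorem matrixCLM_single {n d : ℕ} (σ : Matrix (Fin n) (Fin d) ℝ) (k : Fin d) :
    matrixCLM σ (EuclideanSpace.single k 1) =
      ∑ i, σ i k • EuclideanSpace.single i (1 : ℝ) := by
  ext i
  simp [matrixCLM_apply, Finset.sum_apply, Pi.single_apply]

/-- `tr(σσᵀX)` as a sum over the columns of `σ`. -/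
theorem trace_mul_transpose_mul {n d : ℕ} (σ : Matrix (Fin n) (Fin d) ℝ)
    (X : Matrix (Fin n) (Fin n) ℝ) (B : E n →L[ℝ] E n →L[ℝ] ℝ)
    (hX : ∀ i j, X i j = B (EuclideanSpace.single i 1) (EuclideanSpace.single j 1)) :
    (σ * σ.transpose * X).trace = ∑ k, B (matrixCLM σ (EuclideanSpace.single k 1))
      (matrixCLM σ (EuclideanSpace.single k 1)) := by
  simp only [matrixCLM_single, map_sum, map_smul, _root_.sum_apply,
    _root_.smul_apply, ← hX, Matrix.trace, Matrix.diag, Matrix.mul_apply,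
    Matrix.transpose_apply, Finset.sum_mul, smul_eq_mul, Finset.mul_sum]
  rw [Finset.sum_congr rfl fun i _ => Finset.sum_comm, Finset.sum_comm]
  refine Finset.sum_congr rfl fun k _ => ?_
  refine Finset.sum_congr rfl fun i _ => Finset.sum_congr rfl fun j _ => ?_
  ring

end ObstacleProblem

namespace ObstacleProblem

/-! ### Duality between `H` and `L`. -/

section Legendre

variable {n d : ℕ} {T M : ℝ} {Hlow Hup : E n → ℝ} {D : Data n d}

theorem Admissible.bddAbove_L (h : Admissible T M Hlow Hup D) {t : ℝ} (ht : t ∈ Ico 0 T)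
    (x q : E n) : BddAbove (range fun p : E n => inner ℝ p q - D.H t x p) := by
  -- Coercivity at level `‖q‖` makes `p·q - H ≤ 0` outside the ball of radius `R`; inside it, `Hlow`
  -- gives the bound.
  obtain ⟨R, hR, hcoer⟩ := h.coercive_H ‖q‖
  obtain ⟨A, hA⟩ := h.locallyBounded_Hlow R
  have hA0 : 0 ≤ A := (abs_nonneg _).trans (hA 0 (by simpa using hR))
  refine ⟨R * ‖q‖ + A, ?_⟩
  rintro _ ⟨p, rfl⟩
  have h1 : inner ℝ p q ≤ ‖p‖ * ‖q‖ := real_inner_le_norm p q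
  simp only
  rcases lt_or_ge R ‖p‖ with hp | hp
  · have h2 := hcoer t ht x p hp
    rw [le_div_iff₀ (hR.trans_lt hp)] at h2
    have : 0 ≤ R * ‖q‖ := by positivity
    linarith
  · have h2 := (h.isGLB_H p).1 ⟨t, ht, x, rfl⟩
    have h3 := (abs_le.1 (hA p hp)).1
    have : ‖p‖ * ‖q‖ ≤ R * ‖q‖ := by gcongr
    linarith

theorem Admissible.le_L (h : Admissible T M Hlow Hup D) {t : ℝ} (ht : t ∈ Ico 0 T)
    (x q p : E n) : inner ℝ p q - D.H t x p ≤ D.L t x q :=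
  le_ciSup (h.bddAbove_L ht x q) p

/-- Test the supremum with the slope of length `R` in the direction of `q`. For `q = 0` the
convention `0⁻¹ = 0` makes this slope zero. -/
theorem Admissible.mul_norm_sub_le_L (h : Admissible T M Hlow Hup D) {t : ℝ} (ht : t ∈ Ico 0 T)
    {R A : ℝ} (hR : 0 ≤ R) (hA : ∀ p, ‖p‖ ≤ R → |Hup p| ≤ A) (x q : E n) :
    R * ‖q‖ - A ≤ D.L t x q := by
  have hp : ‖R • (‖q‖⁻¹ • q)‖ ≤ R := by
    rw [norm_smul, Real.norm_of_nonneg hR, norm_smul, norm_inv, norm_norm]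
    exact mul_le_of_le_one_right hR inv_mul_le_one
  have h1 := h.le_L ht x q (R • (‖q‖⁻¹ • q))
  have h2 := (h.isLUB_H (R • (‖q‖⁻¹ • q))).1 ⟨t, ht, x, rfl⟩
  have h3 := (abs_le.1 (hA _ hp)).2
  have h4 : inner ℝ (R • (‖q‖⁻¹ • q)) q = R * ‖q‖ := by
    rw [real_inner_smul_left, real_inner_smul_left, real_inner_self_eq_norm_sq]
    rcases eq_or_ne ‖q‖ 0 with h0 | h0
    · simp [h0]
    · field_simp
  linarith

theorem Admissible.continuous_H_apply (h : Admissible T M Hlow Hup D) {t : ℝ}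
    (ht : t ∈ Ico 0 T) (x : E n) : Continuous (D.H t x) := by
  rw [← continuousOn_univ]
  exact h.continuous_H.comp (f := fun p : E n => (t, x, p)) (by fun_prop)
    (fun p _ => ⟨ht, mem_univ _⟩)

/-- Almost maximizing slopes in the duality between `H` and `L`, bounded in terms of the
envelopes of `H`. -/
theorem Admissible.exists_L_le (h : Admissible T M Hlow Hup D) {t : ℝ} (ht : t ∈ Ico 0 T)
    {R A ε : ℝ} (hlow : ∀ p, ‖p‖ ≤ R + 1 → |Hlow p| ≤ A) (hup : ∀ p, ‖p‖ ≤ R + 1 → |Hup p| ≤ A)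
    (hε : 0 < ε) (x p : E n) (hp : ‖p‖ ≤ R) :
    ∃ q : E n, ‖q‖ ≤ 2 * A + ε ∧ D.L t x q ≤ inner ℝ p q - D.H t x p + ε := by
  -- An affine minorant of `H(t,x,·)` within `ε` of it at `p`: its slope `q` is an `ε`-subgradient,
  -- and `L(q) ≤ -c`.
  obtain ⟨l, c, hle, heq⟩ := (h.convex_H t ht x).exists_affine_le_of_lt (𝕜 := ℝ) (x := p)
    (a := D.H t x p - ε) (mem_univ _) (by linarith) isClosed_univ
    ((h.continuous_H_apply ht x).lowerSemicontinuous.lowerSemicontinuousOn _)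
  set q : E n := (InnerProductSpace.toDual ℝ (E n)).symm l with hq
  have hl : ∀ w, l w = inner ℝ w q := fun w => by
    rw [real_inner_comm, hq, InnerProductSpace.toDual_symm_apply]
  have hle' : ∀ w, inner ℝ w q + c ≤ D.H t x w := fun w => by
    have := hle ⟨w, mem_univ _⟩
    simpa [hl] using this
  have heq' : inner ℝ p q + c = D.H t x p - ε := by simpa [hl] using heq
  refine ⟨q, ?_, ciSup_le fun w => by have := hle' w; linarith⟩
  -- Testing the minorant one unit away from `p` in the direction of `q` gives `‖q‖ ≤ Hup - Hlow +
  -- ε`, with the two envelopes taken at different points.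
  have he : ‖‖q‖⁻¹ • q‖ ≤ 1 := by
    rw [norm_smul, norm_inv, norm_norm]
    exact inv_mul_le_one
  have hpe : ‖p + ‖q‖⁻¹ • q‖ ≤ R + 1 := (norm_add_le _ _).trans (add_le_add hp he)
  have h1 := hle' (p + ‖q‖⁻¹ • q)
  have h2 : inner ℝ (p + ‖q‖⁻¹ • q) q = inner ℝ p q + ‖q‖ := by
    rw [inner_add_left, real_inner_smul_left, real_inner_self_eq_norm_sq]
    rcases eq_or_ne ‖q‖ 0 with h0 | h0
    · simp [h0]
    · field_simp
  have h3 := (h.isLUB_H (p + ‖q‖⁻¹ • q)).1 ⟨t, ht, x, rfl⟩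
  have h4 := (h.isGLB_H p).1 ⟨t, ht, x, rfl⟩
  have h5 := (abs_le.1 (hup _ hpe)).2
  have h6 := (abs_le.1 (hlow p (by linarith))).1
  linarith

end Legendre

/-! ### Pointwise bounds extracted from the extended norms. -/

section Coefficients

variable {n : ℕ} {F : Type} [NormedAddCommGroup F] {I : Set ℝ} {M : ℝ} {h : ℝ → E n → F}

theorem norm_le_of_parabolicNorm_le (hM : 0 ≤ M) (hh : parabolicNorm I 1 h ≤ ENNReal.ofReal M)
    {t : ℝ} (ht : t ∈ I) (x : E n) : ‖h t x‖ ≤ M := by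
  have h1 : ‖h t x‖ₑ ≤ supNorm I h :=
    (le_iSup (fun x => ‖h t x‖ₑ) x).trans (le_iSup₂ (f := fun t (_ : t ∈ I) => ⨆ x, ‖h t x‖ₑ) t ht)
  have h2 : ‖h t x‖ₑ ≤ ENNReal.ofReal M := h1.trans (le_self_add.trans hh)
  rwa [← ofReal_norm, ENNReal.ofReal_le_ofReal_iff hM] at h2

theorem norm_sub_le_of_parabolicNorm_le (hM : 0 ≤ M)
    (hh : parabolicNorm I 1 h ≤ ENNReal.ofReal M) {t : ℝ} (ht : t ∈ I) (x y : E n) :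
    ‖h t x - h t y‖ ≤ M * ‖x - y‖ := by
  rcases eq_or_ne x y with rfl | hxy
  · simp
  have h1 : ‖h t x - h t y‖ₑ / ENNReal.ofReal (‖x - y‖ ^ (1 : ℝ)) ≤ spaceSeminorm I 1 h := by
    refine le_trans ?_ (le_iSup₂ (f := fun t (_ : t ∈ I) => ⨆ x, ⨆ y, ⨆ (_ : x ≠ y),
      ‖h t x - h t y‖ₑ / ENNReal.ofReal (‖x - y‖ ^ (1 : ℝ))) t ht)
    refine le_trans ?_ (le_iSup _ x)
    refine le_trans ?_ (le_iSup _ y)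
    exact le_iSup (fun _ : x ≠ y => ‖h t x - h t y‖ₑ / ENNReal.ofReal (‖x - y‖ ^ (1 : ℝ))) hxy
  have h2 : ‖h t x - h t y‖ₑ / ENNReal.ofReal (‖x - y‖ ^ (1 : ℝ)) ≤ ENNReal.ofReal M :=
    h1.trans (le_add_self.trans (le_add_self.trans hh))
  have h3 : 0 < ‖x - y‖ := norm_pos_iff.2 (sub_ne_zero.2 hxy)
  rw [Real.rpow_one, ← ofReal_norm, ← ENNReal.ofReal_div_of_pos h3,
    ENNReal.ofReal_le_ofReal_iff hM, div_le_iff₀ h3] at h2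
  exact h2

end Coefficients

end ObstacleProblem

namespace ObstacleProblem

/-! ### The backward operator as an infimum of Gaussian costs. -/

section Backward

variable {n d : ℕ}

/-- `E φ(y + b(t,y)Δ + σ(t,y)√Δ Z)` for a standard Gaussian vector `Z`. -/
noncomputable def Data.gaussAvg (D : Data n d) (t Δ : ℝ) (φ : E n → ℝ) (y : E n) : ℝ :=
  ∫ z, φ (y + Δ • D.b t y + Real.sqrt Δ • matrixCLM (D.σ t y) z) ∂(stdGaussian (E d))

/-- The function minimized in the definition of the backward operator. -/
noncomputable def Data.cost (D : Data n d) (t Δ : ℝ) (φ : E n → ℝ) (x y : E n) : ℝ :=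
  Δ * D.L t x (Δ⁻¹ • (x - y)) + D.gaussAvg t Δ φ y

variable {Ω : Type*} [mΩ : MeasurableSpace Ω] {P : Measure Ω} [IsProbabilityMeasure P]
  {ℱ : Filtration ℝ≥0 mΩ} {W : ℝ≥0 → Ω → E d}

/-- The increment is independent of `ℱ t`, so conditioning reduces to an expectation under its
Gaussian law. -/
theorem IsBrownianMotion.condExp_Y (hW : IsBrownianMotion P ℱ W) (D : Data n d) {t Δ : ℝ}
    (ht : 0 ≤ t) (hΔ : 0 ≤ Δ) {φ : E n → ℝ} (hφ : Continuous φ) (y : E n) :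
    P[fun ω => φ (D.Y W t y (t + Δ) ω) | ℱ t.toNNReal] =ᵐ[P] fun _ => D.gaussAvg t Δ φ y := by
  have hle : t.toNNReal ≤ (t + Δ).toNNReal := Real.toNNReal_le_toNNReal (by linarith)
  set X : Ω → E d := fun ω => W (t + Δ).toNNReal ω - W t.toNNReal ω with hX
  have hmeas : ∀ s, Measurable (W s) := fun s => (hW.adapted s).mono (ℱ.le s) le_rfl
  have hXm : Measurable X := (hmeas _).sub (hmeas _)
  set ψ : E d → ℝ := fun w => φ (y + Δ • D.b t y + matrixCLM (D.σ t y) w) with hψ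
  have hψc : Continuous ψ := by fun_prop
  have hY : (fun ω => φ (D.Y W t y (t + Δ) ω)) = ψ ∘ X := by
    ext ω
    simp [hψ, hX, Data.Y, matrixCLM_apply]
  have h1 : StronglyMeasurable[MeasurableSpace.comap X inferInstance] (ψ ∘ X) :=
    (hψc.measurable.comp (comap_measurable X)).stronglyMeasurable
  have h2 := condExp_indep_eq hXm.comap_le (ℱ.le t.toNNReal) h1 (hW.indep _ _ hle)
  rw [hY]
  refine h2.trans (ae_of_all _ fun _ => ?_)
  have h3 : ∫ ω, (ψ ∘ X) ω ∂P = ∫ w, ψ w ∂(P.map X) :=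
    (integral_map hXm.aemeasurable hψc.aestronglyMeasurable).symm
  simp only
  rw [h3, hX, hW.law _ _ hle, integral_map (by fun_prop) hψc.aestronglyMeasurable,
    Real.coe_toNNReal _ ht, Real.coe_toNNReal _ (by linarith)]
  simp [Data.gaussAvg, hψ]

theorem IsBrownianMotion.backward_eq (hW : IsBrownianMotion P ℱ W) (D : Data n d) {t Δ : ℝ}
    (ht : 0 ≤ t) (hΔ : 0 ≤ Δ) {φ : E n → ℝ} (hφ : Continuous φ) (x : E n) :
    D.backward P ℱ W t Δ φ x = ⨅ y, D.cost t Δ φ x y := by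
  rw [Data.backward, iInf]
  congr 1
  ext r
  constructor
  · rintro ⟨y, c, hc, rfl⟩
    -- Two constants that agree almost everywhere for a probability measure agree at some point, so
    -- `c` is determined.
    obtain ⟨ω, hω⟩ := ((hW.condExp_Y D ht hΔ hφ y).symm.trans hc).exists
    have hω' : D.gaussAvg t Δ φ y = c := hω
    exact ⟨y, by simp only [Data.cost, hω']⟩
  · rintro ⟨y, rfl⟩
    exact ⟨y, _, hW.condExp_Y D ht hΔ hφ y, rfl⟩

theorem Data.integrable_gaussAvg (D : Data n d) (t Δ : ℝ) {φ : E n → ℝ} (hφ : Continuous φ)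
    {B : ℝ} (hB : ∀ x, |φ x| ≤ B) (y : E n) :
    Integrable (fun z => φ (y + Δ • D.b t y + Real.sqrt Δ • matrixCLM (D.σ t y) z))
      (stdGaussian (E d)) :=
  (integrable_const B).mono' (Continuous.aestronglyMeasurable (by fun_prop))
    (ae_of_all _ fun _ => hB _)

variable {T M : ℝ} {Hlow Hup : E n → ℝ} {D : Data n d}

/-- A real infimum over a set unbounded below takes a default value; this bound makes the infima of
the cost genuine. -/
theorem Admissible.bddBelow_cost (h : Admissible T M Hlow Hup D) {t Δ : ℝ} (ht : t ∈ Ico 0 T)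
    (hΔ : 0 ≤ Δ) {φ : E n → ℝ} (hφ : Continuous φ) {B : ℝ} (hB : ∀ x, |φ x| ≤ B) (x : E n) :
    BddBelow (range (D.cost t Δ φ x)) := by
  obtain ⟨A, hA⟩ := h.locallyBounded_Hup 0
  refine ⟨Δ * (-A) - B, ?_⟩
  rintro _ ⟨y, rfl⟩
  have h1 := h.mul_norm_sub_le_L ht le_rfl hA x (Δ⁻¹ • (x - y))
  have h2 : -B ≤ D.gaussAvg t Δ φ y := by
    have := integral_mono (μ := stdGaussian (E d)) (integrable_const (-B))
      (D.integrable_gaussAvg t Δ hφ hB y) fun z => (abs_le.1 (hB _)).1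
    simpa [Data.gaussAvg] using this
  have h3 : Δ * (-A) ≤ Δ * D.L t x (Δ⁻¹ • (x - y)) := by gcongr; linarith
  simp only [Data.cost]
  linarith

/-- The backward operator is monotone and commutes with the addition of constants. -/
theorem Admissible.backward_le_add (h : Admissible T M Hlow Hup D) (hW : IsBrownianMotion P ℱ W)
    {t Δ : ℝ} (ht : t ∈ Ico 0 T) (hΔ : 0 ≤ Δ) {φ ψ : E n → ℝ} (hφ : Continuous φ)
    (hψ : Continuous ψ) {B B' e : ℝ} (hB : ∀ x, |φ x| ≤ B) (hB' : ∀ x, |ψ x| ≤ B')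
    (hle : ∀ x, φ x ≤ ψ x + e) (x : E n) :
    D.backward P ℱ W t Δ φ x ≤ D.backward P ℱ W t Δ ψ x + e := by
  rw [hW.backward_eq D ht.1 hΔ hφ, hW.backward_eq D ht.1 hΔ hψ, ← sub_le_iff_le_add]
  refine le_ciInf fun y => ?_
  rw [sub_le_iff_le_add]
  refine (ciInf_le (h.bddBelow_cost ht hΔ hφ hB x) y).trans ?_
  have h1 : D.gaussAvg t Δ φ y ≤ D.gaussAvg t Δ ψ y + e := by
    have := integral_mono (D.integrable_gaussAvg t Δ hφ hB y)
      ((D.integrable_gaussAvg t Δ hψ hB' y).add (integrable_const e)) fun z => hle _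
    simp only [Pi.add_apply] at this
    rw [integral_add (D.integrable_gaussAvg t Δ hψ hB' y) (integrable_const e)] at this
    simpa [Data.gaussAvg] using this
  simp only [Data.cost]
  linarith

end Backward

end ObstacleProblem

namespace ObstacleProblem

/-! ### Consistency of the backward operator, with error `Δ^{3/2}`. -/

section Consistency

variable {n d : ℕ} {T M K : ℝ} {Hlow Hup : E n → ℝ} {D : Data n d} {u : ℝ → E n → ℝ}
  {D1 : ℝ × E n → ℝ × E n →L[ℝ] ℝ} {D2 : ℝ × E n → ℝ × E n →L[ℝ] ℝ × E n →L[ℝ] ℝ}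

/-- The inclusion `z ↦ (0, σ(t,y) z)`. -/
noncomputable def Data.noise (D : Data n d) (t : ℝ) (y : E n) : E d →L[ℝ] ℝ × E n :=
  (ContinuousLinearMap.inr ℝ ℝ (E n)).comp (matrixCLM (D.σ t y))

theorem Data.noise_apply (D : Data n d) (t : ℝ) (y : E n) (z : E d) :
    D.noise t y z = (0, matrixCLM (D.σ t y) z) := rfl

theorem norm_zero_prod (v : E n) : ‖((0 : ℝ), v)‖ = ‖v‖ := by simp [Prod.norm_def]

theorem norm_inr_comp_le (A : E d →L[ℝ] E n) :
    ‖(ContinuousLinearMap.inr ℝ ℝ (E n)).comp A‖ ≤ ‖A‖ :=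
  ContinuousLinearMap.opNorm_le_bound _ (norm_nonneg _) fun z => by
    simpa [Prod.norm_def] using A.le_opNorm z

theorem Admissible.norm_noise_le (h : Admissible T M Hlow Hup D) (hM : 0 ≤ M) {t : ℝ}
    (ht : t ∈ Ico 0 T) (y : E n) : ‖D.noise t y‖ ≤ M :=
  (norm_inr_comp_le _).trans ((norm_matrixCLM_le _).trans
    (norm_le_of_parabolicNorm_le hM h.norm_σ ht y))

theorem Admissible.norm_noise_sub_le (h : Admissible T M Hlow Hup D) (hM : 0 ≤ M) {t : ℝ}
    (ht : t ∈ Ico 0 T) (x y : E n) : ‖D.noise t x - D.noise t y‖ ≤ M * ‖x - y‖ := by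
  rw [Data.noise, Data.noise, ← ContinuousLinearMap.comp_sub, ← matrixCLM_sub]
  exact (norm_inr_comp_le _).trans ((norm_matrixCLM_le _).trans
    (norm_sub_le_of_parabolicNorm_le hM h.norm_σ ht x y))

/-- `Σ_k D²(σ e_k, σ e_k)`. -/
noncomputable def Data.diffusion (D : Data n d) (B : ℝ × E n →L[ℝ] ℝ × E n →L[ℝ] ℝ) (t : ℝ)
    (y : E n) : ℝ :=
  ∑ k, B (D.noise t y (EuclideanSpace.single k 1)) (D.noise t y (EuclideanSpace.single k 1))

/-- `∂ₜu + b·∂ₓu + ½ tr(σσᵀ∂ₓₓu)`, in terms of the derivatives of `u` in `(t,x)`. -/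
noncomputable def Data.generator (D : Data n d) (D1 : ℝ × E n → ℝ × E n →L[ℝ] ℝ)
    (D2 : ℝ × E n → ℝ × E n →L[ℝ] ℝ × E n →L[ℝ] ℝ) (t : ℝ) (x : E n) : ℝ :=
  D1 (t, x) (1, D.b t x) + D.diffusion (D2 (t, x)) t x / 2

theorem HasBoundedJet.residual_eq (hT : 0 < T)
    (h : HasBoundedJet (closedDomain n T) K (fun z => u z.1 z.2) D1 D2) (D : Data n d) {t : ℝ}
    (ht : t ∈ Icc 0 T) (x : E n) :
    -derivWithin (fun s => u s x) (Icc 0 T) t + D.g t x (gradient (u t) x) (hessian (u t) x) =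
      D.H t x (gradient (u t) x) - D.generator D1 D2 t x := by
  let B : E n →L[ℝ] E n →L[ℝ] ℝ :=
    ((((ContinuousLinearMap.compL ℝ (E n) (ℝ × E n) ℝ).flip
      (ContinuousLinearMap.inr ℝ ℝ (E n))).comp (D2 (t, x))).comp
      (ContinuousLinearMap.inr ℝ ℝ (E n)))
  have hB : ∀ v w, B v w = D2 (t, x) (0, v) (0, w) := fun v w => rfl
  have h1 : (D.σ t x * (D.σ t x).transpose * hessian (u t) x).trace =
      D.diffusion (D2 (t, x)) t x := by
    rw [trace_mul_transpose_mul _ _ B fun i j => h.hessian_apply ht x i j]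
    rfl
  have h2 : D1 (t, x) (1, D.b t x) = D1 (t, x) (1, 0) + D1 (t, x) (0, D.b t x) := by
    rw [← map_add]; simp
  rw [h.derivWithin_time hT ht, Data.g, h1, h.inner_gradient ht, Data.generator, h2]
  ring

theorem abs_bilin_apply_le {V : Type*} [NormedAddCommGroup V]
    [NormedSpace ℝ V] (B : V →L[ℝ] V →L[ℝ] ℝ) {K a b : ℝ} (hB : ‖B‖ ≤ K) (hK : 0 ≤ K) {v w : V}
    (hv : ‖v‖ ≤ a) (hw : ‖w‖ ≤ b) : |B v w| ≤ K * a * b := by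
  have ha := (norm_nonneg v).trans hv
  exact (B.le_opNorm₂ v w).trans (by gcongr)

theorem Admissible.abs_diffusion_le (h : Admissible T M Hlow Hup D) (hM : 0 ≤ M) {t : ℝ}
    (ht : t ∈ Ico 0 T) (hK : 0 ≤ K) (B : ℝ × E n →L[ℝ] ℝ × E n →L[ℝ] ℝ) (hB : ‖B‖ ≤ K)
    (x : E n) : |D.diffusion B t x| ≤ d * (K * M * M) := by
  have h1 : ∀ k, ‖D.noise t x (EuclideanSpace.single k 1)‖ ≤ M := fun k => by
    simpa using (D.noise t x).le_of_opNorm_le (h.norm_noise_le hM ht x)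
      (EuclideanSpace.single k 1)
  refine (Finset.abs_sum_le_sum_abs _ _).trans ((Finset.sum_le_sum fun k _ =>
    abs_bilin_apply_le B hB hK (h1 k) (h1 k)).trans_eq (by simp))

/-- The scheme freezes `σ` at the target `y`, the equation at `x`; this is the price of the
exchange. -/
theorem Admissible.abs_diffusion_sub_le (h : Admissible T M Hlow Hup D) (hM : 0 ≤ M) {t : ℝ}
    (ht : t ∈ Ico 0 T) (hK : 0 ≤ K) (B : ℝ × E n →L[ℝ] ℝ × E n →L[ℝ] ℝ) (hB : ‖B‖ ≤ K)
    (x y : E n) : |D.diffusion B t y - D.diffusion B t x| ≤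
      d * (2 * (K * M * (M * ‖x - y‖))) := by
  have h1 : ∀ y k, ‖D.noise t y (EuclideanSpace.single k 1)‖ ≤ M := fun y k => by
    simpa using (D.noise t y).le_of_opNorm_le (h.norm_noise_le hM ht y)
      (EuclideanSpace.single k 1)
  have h2 : ∀ k, ‖D.noise t y (EuclideanSpace.single k 1) -
      D.noise t x (EuclideanSpace.single k 1)‖ ≤ M * ‖x - y‖ := fun k => by
    rw [norm_sub_rev x y]
    simpa using (D.noise t y - D.noise t x).le_of_opNorm_le (h.norm_noise_sub_le hM ht y x)
      (EuclideanSpace.single k 1)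
  rw [Data.diffusion, Data.diffusion, ← Finset.sum_sub_distrib]
  suffices h3 : ∀ k, |B (D.noise t y (EuclideanSpace.single k 1))
      (D.noise t y (EuclideanSpace.single k 1)) - B (D.noise t x (EuclideanSpace.single k 1))
      (D.noise t x (EuclideanSpace.single k 1))| ≤ 2 * (K * M * (M * ‖x - y‖)) from
    (Finset.abs_sum_le_sum_abs _ _).trans
      ((Finset.sum_le_sum fun k _ => h3 k).trans_eq (by simp))
  intro k
  set v := D.noise t y (EuclideanSpace.single k 1)
  set w := D.noise t x (EuclideanSpace.single k 1)
  have e : B v v - B w w = B v (v - w) + B (v - w) w := by simp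
  rw [e]
  refine (abs_add_le _ _).trans ((add_le_add
    (abs_bilin_apply_le B hB hK (h1 y k) (h2 k))
    (abs_bilin_apply_le B hB hK (h2 k) (h1 x k))).trans_eq (by ring))

theorem Admissible.abs_generator_le (h : Admissible T M Hlow Hup D) (hM : 0 ≤ M)
    (hu : HasBoundedJet (closedDomain n T) K (fun z => u z.1 z.2) D1 D2) {t : ℝ}
    (ht : t ∈ Ico 0 T) (x : E n) :
    |D.generator D1 D2 t x| ≤ K * (1 + M) + d * (K * M * M) / 2 := by
  have hz : (t, x) ∈ closedDomain n T := ⟨⟨ht.1, ht.2.le⟩, mem_univ _⟩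
  have h1 := h.abs_diffusion_le hM ht hu.nonneg (D2 (t, x)) (hu.norm_D2_le _ hz) x
  have h2 : ‖((1 : ℝ), D.b t x)‖ ≤ 1 + M := by
    have := norm_le_of_parabolicNorm_le hM h.norm_b ht x
    rw [Prod.norm_def]
    exact max_le (by simpa using hM) (by simp only; linarith)
  have h3 : |D1 (t, x) (1, D.b t x)| ≤ K * (1 + M) :=
    (D1 (t, x)).le_of_opNorm_le_of_le (hu.norm_D1_le _ hz) h2
  rw [abs_le] at *
  rw [Data.generator]
  constructor <;> linarith

theorem Data.gaussAvg_eq_jet (D : Data n d) (u : ℝ → E n → ℝ) (t Δ : ℝ) (x q : E n) :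
    D.gaussAvg t Δ (u (t + Δ)) (x - Δ • q) = ∫ z, (fun w : ℝ × E n => u w.1 w.2)
      ((t, x) + ((Δ, Δ • (D.b t (x - Δ • q) - q)) + Real.sqrt Δ • D.noise t (x - Δ • q) z))
        ∂(stdGaussian (E d)) := by
  refine integral_congr_ae (ae_of_all _ fun z => ?_)
  simp only [Data.noise_apply, Prod.smul_mk, smul_zero, Prod.mk_add_mk, add_zero]
  congr 1
  rw [smul_sub]
  abel

theorem norm_displacement_le {Δ r : ℝ} (hΔ : 0 ≤ Δ) {b q : E n} (hb : ‖b‖ ≤ M) (hq : ‖q‖ ≤ r) :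
    ‖(Δ, Δ • (b - q))‖ ≤ Δ * (1 + r + M) := by
  have h0 := (norm_nonneg _).trans hq
  have h1 := (norm_nonneg _).trans hb
  rw [Prod.norm_def]
  refine max_le ?_ ?_
  · rw [Real.norm_of_nonneg hΔ]
    exact le_mul_of_one_le_right hΔ (by linarith)
  · simp only
    rw [norm_smul, Real.norm_of_nonneg hΔ]
    have := norm_sub_le b q
    gcongr
    linarith

/-- The constant in the expansion of the Gaussian average for displacements at most `R`. -/
noncomputable def expansionConst (d : ℕ) (T M K R : ℝ) : ℝ :=
  4 * K * (Real.sqrt T ^ 3 * (1 + R + M) ^ 3 +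
      M ^ 3 * ∫ z : E d, ‖z‖ ^ 3 ∂(stdGaussian (E d))) +
    K * (M * R) * Real.sqrt T + K * (1 + R + M) ^ 2 * Real.sqrt T +
    d * (K * M * (M * R)) * Real.sqrt T

theorem expansionConst_nonneg (d : ℕ) {R : ℝ} (hM : 0 ≤ M) (hK : 0 ≤ K) (hR : 0 ≤ R) :
    0 ≤ expansionConst d T M K R := by
  have : 0 ≤ ∫ z : E d, ‖z‖ ^ 3 ∂(stdGaussian (E d)) := integral_nonneg fun _ => by positivity
  rw [expansionConst]
  positivity

/-- For bounded `q`, moving the coefficients from `y` to `x` and the term `D2 m m` cost `O(Δ²)`.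
Only the third Gaussian moment in the Taylor remainder is truly of order `Δ^{3/2}`. -/
theorem Admissible.abs_gaussAvg_sub_le (h : Admissible T M Hlow Hup D) (hM : 0 ≤ M)
    (hu : HasBoundedJet (closedDomain n T) K (fun z => u z.1 z.2) D1 D2) {t Δ R : ℝ}
    (ht : 0 ≤ t) (hΔ : 0 < Δ) (htΔ : t + Δ ≤ T) (x q : E n) (hq : ‖q‖ ≤ R) :
    |D.gaussAvg t Δ (u (t + Δ)) (x - Δ • q) -
      (u t x + Δ * (D.generator D1 D2 t x - inner ℝ (gradient (u t) x) q))| ≤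
      expansionConst d T M K R * (Δ * Real.sqrt Δ) := by
  have htT : t ∈ Ico 0 T := ⟨ht, by linarith⟩
  have htT' : t ∈ Icc 0 T := ⟨ht, by linarith⟩
  have hs0 := Real.sqrt_nonneg Δ
  have hsT : Real.sqrt Δ ≤ Real.sqrt T := Real.sqrt_le_sqrt (by linarith)
  have hsq : Real.sqrt Δ ^ 2 = Δ := Real.sq_sqrt hΔ.le
  have hK := hu.nonneg
  have hR := (norm_nonneg _).trans hq
  set s := Real.sqrt Δ
  set τ := Real.sqrt T
  set y := x - Δ • q with hy
  have hxy : ‖x - y‖ ≤ Δ * R := by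
    rw [hy, sub_sub_cancel, norm_smul, Real.norm_of_nonneg hΔ.le]
    gcongr
  have hz : (t, x) ∈ closedDomain n T := ⟨htT', mem_univ _⟩
  have hmem : ∀ w : E n, (t, x) + (Δ, w) ∈ closedDomain n T := fun w =>
    ⟨⟨by simp; linarith, htΔ⟩, mem_univ _⟩
  have hb := norm_le_of_parabolicNorm_le hM h.norm_b htT y
  have hm := norm_displacement_le (b := D.b t y) hΔ.le hb hq
  have key := abs_integral_sub_taylor_two_le
    (f := fun z => (fun w : ℝ × E n => u w.1 w.2)
      ((t, x) + ((Δ, Δ • (D.b t y - q)) + s • D.noise t y z)))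
    (by
      have h1 := D.integrable_gaussAvg t Δ (hu.continuous_slice (t := t + Δ) ⟨by linarith, htΔ⟩)
        (fun w => hu.abs_le (t + Δ, w) ⟨⟨by linarith, htΔ⟩, mem_univ _⟩) y
      refine h1.congr (ae_of_all _ fun z => ?_)
      simp only [Data.noise_apply, Prod.smul_mk, smul_zero, Prod.mk_add_mk, add_zero]
      congr 1
      rw [hy, smul_sub]
      abel)
    (D1 (t, x)) (D2 (t, x)) (u t x) K s (Δ * (1 + R + M)) M (Δ, Δ • (D.b t y - q))
    (D.noise t y) hs0 hK hm (h.norm_noise_le hM htT y)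
    (fun z => hu.abs_taylor_two_le hz (by
      simp only [Data.noise_apply, Prod.smul_mk, smul_zero, Prod.mk_add_mk, add_zero]
      exact hmem _))
  rw [← D.gaussAvg_eq_jet u t Δ x q, ← hy] at key
  have e1 : |D1 (t, x) (Δ, Δ • (D.b t y - q)) - Δ * (D1 (t, x) (1, D.b t x) -
      inner ℝ (gradient (u t) x) q)| ≤ K * (Δ * (M * (Δ * R))) := by
    have e : D1 (t, x) (Δ, Δ • (D.b t y - q)) - Δ * (D1 (t, x) (1, D.b t x) -
        inner ℝ (gradient (u t) x) q) = D1 (t, x) (0, Δ • (D.b t y - D.b t x)) := by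
      rw [real_inner_comm, hu.inner_gradient htT', ← smul_eq_mul, ← map_sub, ← map_smul,
        ← map_sub]
      congr 1
      ext1
      · simp
      · simp [smul_sub]
    rw [e]
    refine (D1 (t, x)).le_of_opNorm_le_of_le (hu.norm_D1_le _ hz) ?_
    rw [norm_zero_prod, norm_smul, Real.norm_of_nonneg hΔ.le, norm_sub_rev]
    gcongr
    exact (norm_sub_le_of_parabolicNorm_le hM h.norm_b htT x y).trans (by gcongr)
  have e2 := abs_bilin_apply_le (D2 (t, x)) (hu.norm_D2_le _ hz) hK hm hm
  have e3 := h.abs_diffusion_sub_le hM htT hK (D2 (t, x)) (hu.norm_D2_le _ hz) x y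
  have e4 : |Δ / 2 * (D.diffusion (D2 (t, x)) t y - D.diffusion (D2 (t, x)) t x)| ≤
      Δ * (d * (K * M * (M * (Δ * R)))) := by
    rw [abs_mul, abs_of_nonneg (by positivity)]
    calc _ ≤ Δ / 2 * (d * (2 * (K * M * (M * ‖x - y‖)))) := by gcongr
      _ ≤ Δ / 2 * (d * (2 * (K * M * (M * (Δ * R))))) := by gcongr
      _ = _ := by ring
  -- Since `Δ ≤ T`, higher powers of `Δ` are reduced to `Δ√Δ` at the price of powers of `√T`.
  have t1 : Δ * Δ ≤ Δ * s * τ := by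
    calc Δ * Δ = Δ * s * s := by rw [show Δ * s * s = Δ * s ^ 2 by ring, hsq]
      _ ≤ _ := by gcongr
  have t2 : Δ ^ 3 ≤ Δ * s * τ ^ 3 := by
    calc Δ ^ 3 = Δ * s * s ^ 3 := by
          rw [show Δ * s * s ^ 3 = Δ * (s ^ 2) ^ 2 by ring, hsq]; ring
      _ ≤ _ := by gcongr
  have t3 : s ^ 3 = Δ * s := by rw [pow_succ, hsq]
  have f1 : K * (Δ * (M * (Δ * R))) ≤ K * (M * R) * τ * (Δ * s) := by
    calc _ = K * (M * R) * (Δ * Δ) := by ring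
      _ ≤ K * (M * R) * (Δ * s * τ) := by gcongr
      _ = _ := by ring
  have f2 : K * (Δ * (1 + R + M)) * (Δ * (1 + R + M)) ≤ K * (1 + R + M) ^ 2 * τ * (Δ * s) := by
    calc _ = K * (1 + R + M) ^ 2 * (Δ * Δ) := by ring
      _ ≤ K * (1 + R + M) ^ 2 * (Δ * s * τ) := by gcongr
      _ = _ := by ring
  have f3 : Δ * (d * (K * M * (M * (Δ * R)))) ≤ d * (K * M * (M * R)) * τ * (Δ * s) := by
    calc _ = d * (K * M * (M * R)) * (Δ * Δ) := by ring
      _ ≤ d * (K * M * (M * R)) * (Δ * s * τ) := by gcongr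
      _ = _ := by ring
  have f4 : 4 * K * ((Δ * (1 + R + M)) ^ 3 + s ^ 3 * (M ^ 3 *
        ∫ z : E d, ‖z‖ ^ 3 ∂(stdGaussian (E d)))) ≤
      4 * K * (τ ^ 3 * (1 + R + M) ^ 3 + M ^ 3 *
        ∫ z : E d, ‖z‖ ^ 3 ∂(stdGaussian (E d))) * (Δ * s) := by
    rw [t3, mul_pow]
    calc _ ≤ 4 * K * (Δ * s * τ ^ 3 * (1 + R + M) ^ 3 + Δ * s * (M ^ 3 *
          ∫ z : E d, ‖z‖ ^ 3 ∂(stdGaussian (E d)))) := by gcongr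
      _ = _ := by ring
  have hd : D.generator D1 D2 t x = D1 (t, x) (1, D.b t x) +
    D.diffusion (D2 (t, x)) t x / 2 := rfl
  have hc : ∑ k, (D2 (t, x)) (D.noise t y (EuclideanSpace.single k 1))
    (D.noise t y (EuclideanSpace.single k 1)) = D.diffusion (D2 (t, x)) t y := rfl
  rw [hc, hsq] at key
  have hexp : expansionConst d T M K R * (Δ * s) = 4 * K * (τ ^ 3 * (1 + R + M) ^ 3 + M ^ 3 *
        ∫ z : E d, ‖z‖ ^ 3 ∂(stdGaussian (E d))) * (Δ * s) + K * (M * R) * τ * (Δ * s) +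
      K * (1 + R + M) ^ 2 * τ * (Δ * s) + d * (K * M * (M * R)) * τ * (Δ * s) := by
    rw [expansionConst]; ring
  rw [hexp, hd]
  have f2' : 0 ≤ K * (Δ * (1 + R + M)) * (Δ * (1 + R + M)) := by positivity
  rw [abs_le] at *
  constructor <;> linarith [key.1, key.2, e1.1, e1.2, e2.1, e2.2, e4.1, e4.2]

/-- Meant for large `q`: expanding to first order around the already shifted point keeps the loss
linear in `‖q‖` with slope `K`, where expanding at `(t,x)` would give higher powers. -/
theorem Admissible.le_gaussAvg (h : Admissible T M Hlow Hup D) (hM : 0 ≤ M)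
    (hu : HasBoundedJet (closedDomain n T) K (fun z => u z.1 z.2) D1 D2) {t Δ : ℝ}
    (ht : 0 ≤ t) (hΔ : 0 < Δ) (htΔ : t + Δ ≤ T) (x q : E n) :
    u t x - Δ * (K * (1 + ‖q‖ + M) +
      K * (M ^ 2 * ∫ z : E d, ‖z‖ ^ 2 ∂(stdGaussian (E d)))) ≤
      D.gaussAvg t Δ (u (t + Δ)) (x - Δ • q) := by
  have htT : t ∈ Ico 0 T := ⟨ht, by linarith⟩
  have htT' : t ∈ Icc 0 T := ⟨ht, by linarith⟩
  have hsq : Real.sqrt Δ ^ 2 = Δ := Real.sq_sqrt hΔ.le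
  have hK := hu.nonneg
  set s := Real.sqrt Δ
  set y := x - Δ • q with hy
  have hz : (t, x) ∈ closedDomain n T := ⟨htT', mem_univ _⟩
  have hmem : ∀ w : E n, (t, x) + (Δ, w) ∈ closedDomain n T := fun w =>
    ⟨⟨by simp; linarith, htΔ⟩, mem_univ _⟩
  have hb := norm_le_of_parabolicNorm_le hM h.norm_b htT y
  have hm := norm_displacement_le (b := D.b t y) hΔ.le hb (le_refl ‖q‖)
  set m : ℝ × E n := (Δ, Δ • (D.b t y - q)) with hmdef
  have hzm : (t, x) + m ∈ closedDomain n T := hmem _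
  have key := le_integral_of_taylor_one
    (f := fun z => (fun w : ℝ × E n => u w.1 w.2) ((t, x) + (m + s • D.noise t y z)))
    (by
      have h1 := D.integrable_gaussAvg t Δ (hu.continuous_slice (t := t + Δ) ⟨by linarith, htΔ⟩)
        (fun w => hu.abs_le (t + Δ, w) ⟨⟨by linarith, htΔ⟩, mem_univ _⟩) y
      refine h1.congr (ae_of_all _ fun z => ?_)
      simp only [hmdef, Data.noise_apply, Prod.smul_mk, smul_zero, Prod.mk_add_mk, add_zero]
      congr 1
      rw [hy, smul_sub]
      abel)
    (D1 ((t, x) + m)) ((fun w : ℝ × E n => u w.1 w.2) ((t, x) + m)) K s M (D.noise t y) hK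
    (h.norm_noise_le hM htT y)
    (fun z => by
      have := hu.abs_taylor_one_le hzm (w := (t, x) + (m + s • D.noise t y z)) (by
        simp only [hmdef, Data.noise_apply, Prod.smul_mk, smul_zero, Prod.mk_add_mk, add_zero]
        exact hmem _)
      rwa [show (t, x) + (m + s • D.noise t y z) - ((t, x) + m) = s • D.noise t y z by abel]
        at this)
  rw [hmdef, ← D.gaussAvg_eq_jet u t Δ x q, ← hy, hsq] at key
  have h1 := hu.abs_sub_le hz hzm
  rw [add_sub_cancel_left] at h1
  have h2 : K * ‖m‖ ≤ K * (Δ * (1 + ‖q‖ + M)) := by gcongr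
  have h3 := (abs_le.1 h1).1
  simp only at h3
  linarith

/-- Consistency of the backward operator with the equation. -/
theorem exists_consistency (n d : ℕ) {T M K A : ℝ} (hT : 0 < T) (hM : 0 ≤ M) (hK : 0 ≤ K)
    (hA : 0 ≤ A) (Hlow Hup : E n → ℝ) (hlow : ∀ p, ‖p‖ ≤ K + 1 → |Hlow p| ≤ A)
    (hup : ∀ p, ‖p‖ ≤ K + 1 → |Hup p| ≤ A) :
    ∃ C : ℝ, 0 ≤ C ∧ ∀ (D : Data n d), Admissible T M Hlow Hup D → ∀ (u : ℝ → E n → ℝ)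
      (D1 : ℝ × E n → ℝ × E n →L[ℝ] ℝ) (D2 : ℝ × E n → ℝ × E n →L[ℝ] ℝ × E n →L[ℝ] ℝ),
      HasBoundedJet (closedDomain n T) K (fun z => u z.1 z.2) D1 D2 →
      ∀ t Δ : ℝ, 0 ≤ t → 0 < Δ → t + Δ ≤ T → ∀ x,
      |(⨅ y, D.cost t Δ (u (t + Δ)) x y) - (u t x - Δ *
        (-derivWithin (fun s => u s x) (Icc 0 T) t +
          D.g t x (gradient (u t) x) (hessian (u t) x)))| ≤ C * (Δ * Real.sqrt Δ) := by
  set κ : ℝ := ∫ z : E d, ‖z‖ ^ 2 ∂(stdGaussian (E d)) with hκ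
  have hκ0 : 0 ≤ κ := integral_nonneg fun _ => by positivity
  -- `R₁` bounds the near-optimal `q` of `exists_L_le` with `ε = √Δ`. `R₂` is the threshold beyond
  -- which `(K+1)‖q‖ - A` outweighs the loss in `le_gaussAvg` and the residual of the equation.
  set R₁ := 2 * A + Real.sqrt T with hR₁
  set R₂ := 2 * A + K * (1 + M) + K * (M ^ 2 * κ) + (K * (1 + M) + d * (K * M * M) / 2)
    with hR₂
  have hR₁0 : 0 ≤ R₁ := by positivity
  have hR₂0 : 0 ≤ R₂ := by positivity
  have hC₁ := expansionConst_nonneg (T := T) d hM hK hR₁0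
  have hC₂ := expansionConst_nonneg (T := T) d hM hK hR₂0
  refine ⟨expansionConst d T M K R₁ + 1 + expansionConst d T M K R₂, by positivity, ?_⟩
  intro D h u D1 D2 hu t Δ ht hΔ htΔ x
  have htT : t ∈ Ico 0 T := ⟨ht, by linarith⟩
  have htT' : t ∈ Icc 0 T := ⟨ht, by linarith⟩
  rw [hu.residual_eq hT D htT' x]
  set p := gradient (u t) x
  have hp : ‖p‖ ≤ K := hu.norm_gradient_le htT' x
  have hs0 : 0 < Real.sqrt Δ := Real.sqrt_pos.2 hΔ
  have hsT : Real.sqrt Δ ≤ Real.sqrt T := Real.sqrt_le_sqrt (by linarith)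
  have hΔs : 0 < Δ * Real.sqrt Δ := by positivity
  have hΔ' : t + Δ ∈ Icc 0 T := ⟨by linarith, htΔ⟩
  have hbdd := h.bddBelow_cost htT hΔ.le (hu.continuous_slice hΔ')
    (fun w => hu.abs_le (t + Δ, w) ⟨hΔ', mem_univ _⟩) x
  have hcost : ∀ q, D.cost t Δ (u (t + Δ)) x (x - Δ • q) =
      Δ * D.L t x q + D.gaussAvg t Δ (u (t + Δ)) (x - Δ • q) := fun q => by
    rw [Data.cost, sub_sub_cancel, inv_smul_smul₀ hΔ.ne']
  rw [abs_le]
  constructor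
  · rw [neg_le_sub_iff_le_add, ← sub_le_iff_le_add]
    refine le_ciInf fun y => ?_
    obtain ⟨q, rfl⟩ : ∃ q, y = x - Δ • q :=
      ⟨Δ⁻¹ • (x - y), by rw [smul_inv_smul₀ hΔ.ne', sub_sub_cancel]⟩
    rw [hcost, sub_le_iff_le_add]
    rcases le_or_gt ‖q‖ R₂ with hq | hq
    · have h1 := (abs_le.1 (h.abs_gaussAvg_sub_le hM hu ht hΔ htΔ x q hq)).1
      have h2 : Δ * (inner ℝ p q - D.H t x p) ≤ Δ * D.L t x q := by
        gcongr; exact h.le_L htT x q p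
      have h3 : 0 ≤ (expansionConst d T M K R₁ + 1) * (Δ * Real.sqrt Δ) := by positivity
      linarith
    -- Large `q`: the slope surplus `(K+1) - K = 1` leaves `‖q‖ - R₂ > 0`.
    · have h1 := h.le_gaussAvg hM hu ht hΔ htΔ x q
      have h2 : Δ * ((K + 1) * ‖q‖ - A) ≤ Δ * D.L t x q := by
        gcongr; exact h.mul_norm_sub_le_L htT (by positivity) hup x q
      have h3 : 0 ≤ (expansionConst d T M K R₁ + 1 + expansionConst d T M K R₂) *
        (Δ * Real.sqrt Δ) := by positivity
      have h4 := (h.isGLB_H p).1 ⟨t, htT, x, rfl⟩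
      have h5 := (abs_le.1 (hlow p (by linarith))).1
      have h6 := (abs_le.1 (h.abs_generator_le hM hu htT x)).2
      have h7 : 0 ≤ Δ * ((K + 1) * ‖q‖ - A - (K * (1 + ‖q‖ + M) + K * (M ^ 2 * κ)) +
          (D.H t x p - D.generator D1 D2 t x)) := by
        refine mul_nonneg hΔ.le ?_
        linarith
      linarith
  -- Tolerance `√Δ` in the duality costs `Δ√Δ`, which is the `+ 1` in the constant.
  · obtain ⟨q, hq, hL⟩ := h.exists_L_le htT hlow hup hs0 x p hp
    have h1 := (abs_le.1 (h.abs_gaussAvg_sub_le hM hu ht hΔ htΔ x q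
      (hq.trans (show 2 * A + Real.sqrt Δ ≤ R₁ by linarith)))).2
    have h2 := ciInf_le hbdd (x - Δ • q)
    rw [hcost] at h2
    have h3 : Δ * D.L t x q ≤ Δ * (inner ℝ p q - D.H t x p + Real.sqrt Δ) := by gcongr
    have h4 : 0 ≤ expansionConst d T M K R₂ * (Δ * Real.sqrt Δ) := by positivity
    linarith

end Consistency

end ObstacleProblem

namespace ObstacleProblem

/-! ### Propagation of the local error through the scheme. -/

section Convergence

variable {n d : ℕ} {T M K Δ : ℝ} {Hlow Hup : E n → ℝ} {D : Data n d} {u v : ℝ → E n → ℝ}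
  {Ω : Type*} [mΩ : MeasurableSpace Ω] {P : Measure Ω} [IsProbabilityMeasure P]
  {ℱ : Filtration ℝ≥0 mΩ} {W : ℝ≥0 → Ω → E d}
  {D1 : ℝ × E n → ℝ × E n →L[ℝ] ℝ} {D2 : ℝ × E n → ℝ × E n →L[ℝ] ℝ × E n →L[ℝ] ℝ}

/-- Passage from the obstacle equation to approximate dynamic programming: both entries being
nonpositive gives one inequality, and whichever entry vanishes gives the other. -/
theorem abs_sub_min_le_of_max_eq_zero {a S f e Δ δ : ℝ} (hΔ : 0 ≤ Δ) (he : max e (a - f) = 0)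
    (hS : |S - (a - Δ * e)| ≤ δ) : |a - min S f| ≤ δ := by
  have he0 : e ≤ 0 := he ▸ le_max_left _ _
  have haf : a - f ≤ 0 := he ▸ le_max_right _ _
  have hδ : 0 ≤ δ := (abs_nonneg _).trans hS
  have hΔe : Δ * e ≤ 0 := mul_nonpos_of_nonneg_of_nonpos hΔ he0
  rw [abs_le] at hS
  have hle : a - δ ≤ min S f := le_min (by linarith) (by linarith)
  have hge : min S f ≤ a + δ := by
    rcases max_choice e (a - f) with h | h
    · have : e = 0 := h ▸ he
      subst this
      exact (min_le_left _ _).trans (by linarith)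
    · have : a - f = 0 := h ▸ he
      exact (min_le_right _ _).trans (by linarith)
  rw [abs_le]
  constructor <;> linarith

theorem eq_min_of_max_div_eq_zero {a S f Δ : ℝ} (hΔ : 0 < Δ)
    (h : max ((a - S) / Δ) (a - f) = 0) : a = min S f := by
  have h1 : (a - S) / Δ ≤ 0 := h ▸ le_max_left _ _
  have h2 : a - f ≤ 0 := h ▸ le_max_right _ _
  rw [div_le_iff₀ hΔ, zero_mul] at h1
  refine le_antisymm (le_min (by linarith) (by linarith)) ?_
  rcases max_choice ((a - S) / Δ) (a - f) with h3 | h3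
  · have h4 : (a - S) / Δ = 0 := h3 ▸ h
    rw [div_eq_zero_iff, or_iff_left hΔ.ne'] at h4
    exact (min_le_left _ _).trans (by linarith)
  · have h4 : a - f = 0 := h3 ▸ h
    exact (min_le_right _ _).trans (by linarith)

theorem abs_min_sub_min_le {a b f δ : ℝ} (h : |a - b| ≤ δ) : |min a f - min b f| ≤ δ :=
  (abs_min_sub_min_le_max a f b f).trans
    (max_le h (by simpa using (abs_nonneg _).trans h))

/-- If the smooth solution satisfies the dynamic programming principle up to an error `δ` at each
time step, then the distance to the scheme is controlled by the number of steps. -/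
theorem IsSchemeSolution.abs_sub_le (hD : Admissible T M Hlow Hup D)
    (hW : IsBrownianMotion P ℱ W) (hΔ : Δ ∈ Ioo 0 T) (hv : IsSchemeSolution P ℱ W T D Δ v)
    (hu : HasBoundedJet (closedDomain n T) K (fun z => u z.1 z.2) D1 D2)
    (hterm : ∀ x, u T x = D.U x) {δ : ℝ}
    (hstep : ∀ t, 0 ≤ t → t + Δ ≤ T → ∀ x,
      |u t x - min (D.backward P ℱ W t Δ (u (t + Δ)) x) (D.f t x)| ≤ δ) (m : ℕ) :
    ∀ t ∈ Icc 0 T, T - Δ - m * Δ < t → ∀ x, |u t x - v t x| ≤ 2 * K * Δ + δ + m * δ := by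
  have hδ : 0 ≤ δ := (abs_nonneg _).trans (hstep 0 le_rfl (by linarith [hΔ.2]) 0)
  have htime : ∀ t ∈ Icc 0 T, ∀ x, T - t ≤ Δ → |D.U x - u t x| ≤ K * Δ := fun t ht x hle => by
    have h1 := hu.abs_sub_le (z := (t, x)) (w := (T, x)) ⟨ht, mem_univ _⟩
      ⟨⟨ht.1.trans ht.2, le_rfl⟩, mem_univ _⟩
    have h2 : ‖((T, x) : ℝ × E n) - (t, x)‖ ≤ Δ := by
      rw [Prod.norm_def]
      simpa [abs_of_nonneg (sub_nonneg.2 ht.2), hΔ.1.le] using hle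
    rw [← hterm]
    exact h1.trans (mul_le_mul_of_nonneg_left h2 hu.nonneg)
  have hlast : ∀ t ∈ Icc 0 T, T - Δ < t → ∀ x, |u t x - v t x| ≤ 2 * K * Δ + δ := by
    intro t ht hlt x
    have hfun : u T = D.U := funext hterm
    have h1 := hstep (T - Δ) (by linarith [hΔ.2]) (by linarith) x
    rw [sub_add_cancel, hfun] at h1
    have h2 := htime t ht x (by linarith)
    have h3 := htime (T - Δ) ⟨by linarith [hΔ.2], by linarith [hΔ.1]⟩ x (by linarith)
    rw [hv.last t ⟨hlt, ht.2⟩ x, Data.lastInterval]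
    set w := min (D.backward P ℱ W (T - Δ) Δ D.U x) (D.f (T - Δ) x)
    have hθ0 : 0 ≤ (T - t) / Δ := div_nonneg (by linarith [ht.2]) hΔ.1.le
    have hθ1 : (T - t) / Δ ≤ 1 := (div_le_one hΔ.1).2 (by linarith)
    have hθ : (t + Δ - T) / Δ = 1 - (T - t) / Δ := by
      have := hΔ.1.ne'
      field_simp
      ring
    -- The interpolation weights sum to one, so the error is a time increment of `u` plus a fraction
    -- of the error at `T - Δ`.
    have e : u t x - ((t + Δ - T) / Δ * D.U x + (T - t) / Δ * w) =
        -(D.U x - u t x) + (T - t) / Δ * ((D.U x - u (T - Δ) x) + (u (T - Δ) x - w)) := by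
      rw [hθ]; ring
    have h4 : |(D.U x - u (T - Δ) x) + (u (T - Δ) x - w)| ≤ K * Δ + δ :=
      (abs_add_le _ _).trans (add_le_add h3 h1)
    have h5 : (T - t) / Δ * |(D.U x - u (T - Δ) x) + (u (T - Δ) x - w)| ≤ K * Δ + δ :=
      (mul_le_of_le_one_left (abs_nonneg _) hθ1).trans h4
    rw [e]
    refine (abs_add_le _ _).trans ?_
    rw [abs_neg, abs_mul, abs_of_nonneg hθ0]
    linarith
  -- Each further step back in time preserves the previous bound by nonexpansiveness and adds one
  -- `δ`.
  induction m with
  | zero => intro t ht hlt x; simpa using hlast t ht (by simpa using hlt) x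
  | succ m ih =>
    intro t ht hlt x
    push_cast at hlt ⊢
    rcases lt_or_ge (T - Δ) t with h | h
    · have := hlast t ht h x
      have : 0 ≤ ((m : ℝ) + 1) * δ := by positivity
      linarith
    · have htT : t ∈ Ico 0 T := ⟨ht.1, by linarith [hΔ.1]⟩
      have htΔ : t + Δ ∈ Icc 0 T := ⟨by linarith [ht.1, hΔ.1], by linarith⟩
      have hi := ih (t + Δ) htΔ (by linarith)
      obtain ⟨B, hB⟩ := hv.bounded
      have hvc : Continuous (v (t + Δ)) := by
        rw [← continuousOn_univ]
        exact hv.continuousOn.comp (f := fun y : E n => (t + Δ, y)) (by fun_prop)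
          (fun y _ => ⟨htΔ, mem_univ _⟩)
      have huc := hu.continuous_slice htΔ
      have huB : ∀ y, |u (t + Δ) y| ≤ K := fun y => hu.abs_le (t + Δ, y) ⟨htΔ, mem_univ _⟩
      have h1 := hD.backward_le_add (e := 2 * K * Δ + δ + m * δ) hW htT hΔ.1.le huc hvc huB (hB _ htΔ)
        (fun y => by have := (abs_le.1 (hi y)).2; linarith) x
      have h2 := hD.backward_le_add (e := 2 * K * Δ + δ + m * δ) hW htT hΔ.1.le hvc huc (hB _ htΔ) huB
        (fun y => by have := (abs_le.1 (hi y)).1; linarith) x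
      have h3 := abs_min_sub_min_le (f := D.f t x) (abs_sub_le_iff.2
        ⟨sub_le_iff_le_add'.2 h1, sub_le_iff_le_add'.2 h2⟩)
      have h4 := eq_min_of_max_div_eq_zero hΔ.1 (hv.equation t ⟨ht.1, h⟩ x)
      have h5 := hstep t ht.1 (by linarith) x
      rw [h4]
      refine (_root_.abs_sub_le _ _ _).trans ((add_le_add h5 h3).trans ?_)
      linarith

end Convergence

end ObstacleProblem


/-! ### Choice of the constant and conclusion. -/

/-- The constant `C` is chosen before the data, the solution, the probability space and the time
step: it depends only on `n`, `d`, `T`, `M`, the envelopes of the Hamiltonian, and a bound `K` for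
the derivatives of `u` of order at most four. -/
theorem mainTheorem8 (n d : ℕ) (T M : ℝ) (hT : 0 < T) (hM : 0 < M)
    (Hlow Hup : ObstacleProblem.E n → ℝ) (K : ℝ) :
    ∃ C : ℝ, ∀ D : ObstacleProblem.Data n d, ObstacleProblem.Admissible T M Hlow Hup D →
      ∀ u : ℝ → ObstacleProblem.E n → ℝ,
        ObstacleProblem.IsSmoothBounded T u →
        (∀ k ≤ 4, ∀ z ∈ ObstacleProblem.closedDomain n T,
          ObstacleProblem.derivNorm T u k z ≤ K) →
        ObstacleProblem.IsClassicalSolution T D u →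
        ∀ (Ω : Type*) (mΩ : MeasurableSpace Ω) (P : Measure Ω), IsProbabilityMeasure P →
        ∀ (ℱ : Filtration ℝ≥0 mΩ) (W : ℝ≥0 → Ω → ObstacleProblem.E d),
          ObstacleProblem.IsBrownianMotion P ℱ W →
          ∀ Δ ∈ Ioo 0 T, ∀ uΔ : ℝ → ObstacleProblem.E n → ℝ,
            ObstacleProblem.IsSchemeSolution P ℱ W T D Δ uΔ →
            ∀ t ∈ Icc 0 T, ∀ x, |u t x - uΔ t x| ≤ C * Real.sqrt Δ := by
  -- The constant precedes the data, so a negative `K` or locally unbounded envelopes must be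
  -- treated apart; no data or solution then exists.
  rcases lt_or_ge K 0 with hK | hK
  · refine ⟨0, fun D _ u hu hb => absurd (hu.hasBoundedJet hT hb).nonneg (not_le.2 hK)⟩
  by_cases hA : ∃ A : ℝ, (∀ p, ‖p‖ ≤ K + 1 → |Hlow p| ≤ A) ∧ ∀ p, ‖p‖ ≤ K + 1 → |Hup p| ≤ A
  swap
  · refine ⟨0, fun D hD => absurd ?_ hA⟩
    obtain ⟨A, hA⟩ := hD.locallyBounded_Hlow (K + 1)
    obtain ⟨B, hB⟩ := hD.locallyBounded_Hup (K + 1)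
    exact ⟨max A B, fun p hp => (hA p hp).trans (le_max_left _ _),
      fun p hp => (hB p hp).trans (le_max_right _ _)⟩
  obtain ⟨A, hlow, hup⟩ := hA
  have hA0 : 0 ≤ A := (abs_nonneg _).trans (hlow 0 (by rw [norm_zero]; linarith))
  obtain ⟨C, hC, hcons⟩ := ObstacleProblem.exists_consistency n d hT hM.le hK hA0 Hlow Hup hlow hup
  -- The first term absorbs the `2KΔ` of the last interval; the second is one `C·T` for the local
  -- error there and one for the `⌊T/Δ⌋` steps.
  refine ⟨2 * K * Real.sqrt T + 2 * C * T, ?_⟩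
  intro D hD u hu hb hsol Ω mΩ P hP ℱ W hW Δ hΔ uΔ hv t ht x
  have hjet := hu.hasBoundedJet hT hb
  have hs0 : 0 ≤ Real.sqrt Δ := Real.sqrt_nonneg Δ
  have hm : (⌊T / Δ⌋₊ : ℝ) * Δ ≤ T := by
    rw [← le_div_iff₀ hΔ.1]
    exact Nat.floor_le (div_nonneg hT.le hΔ.1.le)
  -- Together with the last interval, `⌊T/Δ⌋` steps reach strictly past time 0, so every `t` is
  -- covered.
  have hm' : T < (⌊T / Δ⌋₊ + 1 : ℝ) * Δ := by
    rw [← div_lt_iff₀ hΔ.1]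
    exact Nat.lt_floor_add_one _
  refine (hv.abs_sub_le hD hW hΔ hjet hsol.terminal (δ := C * (Δ * Real.sqrt Δ))
    (fun r hr hrΔ y => ?_) ⌊T / Δ⌋₊ t ht (by linarith [ht.1]) x).trans ?_
  · have hrT : r ∈ Ico 0 T := ⟨hr, by linarith [hΔ.1]⟩
    refine ObstacleProblem.abs_sub_min_le_of_max_eq_zero hΔ.1.le (hsol.equation r hrT y) ?_
    rw [hW.backward_eq D hr hΔ.1.le
      (hjet.continuous_slice ⟨by linarith [hΔ.1], hrΔ⟩)]
    exact hcons D hD u _ _ hjet r Δ hr hΔ.1 hrΔ y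
  · have h1 : Δ ≤ Real.sqrt T * Real.sqrt Δ := by
      calc Δ = Real.sqrt Δ * Real.sqrt Δ := (Real.mul_self_sqrt hΔ.1.le).symm
        _ ≤ _ := by gcongr; exact hΔ.2.le
    have h2 : 2 * K * Δ ≤ 2 * K * (Real.sqrt T * Real.sqrt Δ) := by gcongr
    have h3 : C * (Δ * Real.sqrt Δ) ≤ C * (T * Real.sqrt Δ) := by gcongr; exact hΔ.2.le
    have h4 : C * (⌊T / Δ⌋₊ * Δ * Real.sqrt Δ) ≤ C * (T * Real.sqrt Δ) := by gcongr
    linarith
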